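/- Let $\Lambda=\{\lambda\in\mathbb{R}^d:\lambda_i\ge 0,\ \sum_i\lambda_i=1\}$ and let $$P(z,\lambda)=\frac{b_m(\lambda)z^m+\cdots+b_0(\lambda)}{z^n+a_{n-1}(\lambda)z^{n-1}+\cdots+a_0(\lambda)},$$ where the $a_i,b_i$ are real rational functions of $\lambda$ without poles on $\Lambda$, and the denominator of $P$ has no zero on $|z|=1$ for $\lambda\in\Lambda$ (in particular this holds if $P(\cdot,\lambda)$ is stable for all $\lambda\in\Lambda$). Let $k_1,k_2,k_3,k_4\in\mathbb{N}$, let $Q(z)=\sum_{i=-k_3}^{k_4}q_iz^{-i}$ with real coefficients $q_i$, and for a real vector $l=(l_{-k_1},\dots,l_{k_2})$ let $L(z)=\sum_{i=-k_1}^{k_2}l_iz^{-i}$. Write $j$ for the imaginary unit. (i) There are real polynomials $\nu_1(l,\cdot),\nu_2(l,\cdot),\nu_3$ in $(x_1,x_2,\lambda)$, where $\nu_1,\nu_2$ have coefficients depending affinely on $l$ and $\nu_3$ does not depend on $l$, such that for all $l$, all $\lambda\in\Lambda$ and all real $x_1,x_2$ with $x_1^2+x_2^2=1$ one has, with $z=x_1+jx_2$,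 that $\nu_3(x_1,x_2,\lambda)\neq 0$ and $$Q(z)\,[1-zL(z)P(z,\lambda)]=\frac{\nu_1(l,x_1,x_2,\lambda)+j\,\nu_2(l,x_1,x_2,\lambda)}{\nu_3(x_1,x_2,\lambda)}.$$ (ii) Let $\nu_1,\nu_2,\nu_3$ be any such polynomials, let $l$ be a real vector and $\gamma$ a real number. Put $$T(l,\gamma^2,x_1,x_2,\lambda)=\begin{pmatrix}\gamma^2\nu_3^2&\nu_1&\nu_2\\ \nu_1&1&0\\ \nu_2&0&1\end{pmatrix},$$ and let $\deg(T,x)$ and $\deg(T,\lambda)$ be the maximal degrees of the entries of this matrix polynomial in $(x_1,x_2)$ and in $\lambda$, respectively. Let $\bar T$ be obtained from $T$ by multiplying each monomial by the power of $\sum_i\lambda_i$ that makes it homogeneous in $\lambda$ of degree $\deg(T,\lambda)$, and let $$\hat T(l,\gamma^2,x,\lambda)=\bar T\Big(l,\gamma^2,\tfrac{1-x^2}{1+x^2},\tfrac{2x}{1+x^2},\lambda\Big),\qquad x\in\mathbb{R}.$$ Then $$\gamma^2-\big|Q(z)\,[1-zL(z)P(z,\lambda)]\big|^2>0\quad\text{for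 all } z\in\mathbb{C} \text{ with } |z|=1 \text{ and all } \lambda\in\Lambda$$ if and only if there exist $\epsilon>0$ and $k\in\mathbb{N}$ (with $0 \in \mathbb{N}$) such that $$(1+x^2)^{\deg(T,x)}\Big(\hat T(l,\gamma^2,x,\lambda^2)-\epsilon\,\|\lambda\|_2^{2\deg(T,\lambda)}I\Big)\|\lambda\|_2^{2k}$$ is an SOS matrix polynomial in $(x,\lambda)\in\mathbb{R}\times\mathbb{R}^d$, i.e. a finite sum of terms $F^{T}F$ with real $3\times 3$ matrix polynomials $F(x,\lambda)$. Here $\lambda^2=(\lambda_1^2,\dots,\lambda_d^2)$. -/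

import Mathlib

open MvPolynomial

noncomputable section

/-- A real rational function of `d` real variables, written as a quotient of two polynomials. -/
structure RatFn (d : ℕ) where
  num : MvPolynomial (Fin d) ℝ
  den : MvPolynomial (Fin d) ℝ

/-- Value of a rational function at the point `lam`. -/
def RatFn.val {d : ℕ} (r : RatFn d) (lam : Fin d → ℝ) : ℝ :=
  eval lam r.num / eval lam r.den

/-- The uncertain plant
`P(z, lam) = (b_m(lam) z^m + ... + b_0(lam)) / (z^n + a_{n-1}(lam) z^(n-1) + ... + a_0(lam))`,
whose coefficients are rational functions of the uncertainty vector `lam`. -/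
structure UncertainPlant (d : ℕ) where
  m : ℕ
  n : ℕ
  b : Fin (m + 1) → RatFn d
  a : Fin n → RatFn d

namespace UncertainPlant

variable {d : ℕ} (P : UncertainPlant d)

/-- Numerator of the transfer function. -/
def numAt (z : ℂ) (lam : Fin d → ℝ) : ℂ :=
  ∑ i : Fin (P.m + 1), ((P.b i).val lam : ℂ) * z ^ (i : ℕ)

/-- (Monic) denominator of the transfer function. -/
def denAt (z : ℂ) (lam : Fin d → ℝ) : ℂ :=
  z ^ P.n + ∑ i : Fin P.n, ((P.a i).val lam : ℂ) * z ^ (i : ℕ)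

/-- The transfer function `P(z, lam)`. -/
def tf (z : ℂ) (lam : Fin d → ℝ) : ℂ :=
  P.numAt z lam / P.denAt z lam

/-- The frequency response of the plant is well defined over the simplex: the coefficients are
defined at each point of the simplex, and the denominator has no zero on the unit circle.
(The latter holds in particular if the plant is stable, i.e. if all zeros of the denominator lie
in the open unit disc.) -/
structure WellDefined : Prop where
  b_regular : ∀ i, ∀ lam ∈ stdSimplex ℝ (Fin d), eval lam (P.b i).den ≠ 0
  a_regular : ∀ i, ∀ lam ∈ stdSimplex ℝ (Fin d), eval lam (P.a i).den ≠ 0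
  den_ne_zero : ∀ lam ∈ stdSimplex ℝ (Fin d), ∀ z : ℂ, ‖z‖ = 1 → P.denAt z lam ≠ 0

end UncertainPlant

/-- The (non-causal) finite impulse response filter
`c_{-k} z^k + ... + c_{-1} z + c_0 + c_1 z⁻¹ + ... + c_{k'} z^(-k')`;
the entry `i` of the coefficient vector is the coefficient of `z^(k - i)`. -/
def fir (k k' : ℕ) (c : Fin (k + k' + 1) → ℝ) (z : ℂ) : ℂ :=
  ∑ i : Fin (k + k' + 1), (c i : ℂ) * z ^ ((k : ℤ) - ((i : ℕ) : ℤ))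

/-- `Q(z) (1 - z L(z) P(z, lam))`, where `Q`, `L` are the filters with coefficients `q`, `l`. -/
def errorTF {d : ℕ} (P : UncertainPlant d) {k₁ k₂ k₃ k₄ : ℕ}
    (q : Fin (k₃ + k₄ + 1) → ℝ) (l : Fin (k₁ + k₂ + 1) → ℝ)
    (z : ℂ) (lam : Fin d → ℝ) : ℂ :=
  fir k₃ k₄ q z * (1 - z * fir k₁ k₂ l z * P.tf z lam)

/-- Polynomials in the two groups of variables `(x₁, x₂)` and `lam`. -/
abbrev XLamPoly (d : ℕ) := MvPolynomial (Fin 2 ⊕ Fin d) ℝ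

/-- Evaluation of a polynomial in `(x₁, x₂, lam)`. -/
def XLamPoly.at {d : ℕ} (p : XLamPoly d) (x₁ x₂ : ℝ) (lam : Fin d → ℝ) : ℝ :=
  eval (Sum.elim ![x₁, x₂] lam) p

/-- `(ν₁ + j ν₂) / ν₃` expresses `Q(z) (1 - z L(z) P(z, lam))` for `z = x₁ + j x₂` on the unit
circle and `lam` in the simplex, as a fraction with nonvanishing denominator. Here `ν₁`, `ν₂`, `ν₃`
are real polynomials in `(x₁, x₂, lam)`; `ν₁`, `ν₂` depend affinely on the coefficient vector
`l` of `L`, and `ν₃` does not depend on `l`. -/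
structure IsFractionForm {d : ℕ} (P : UncertainPlant d) {k₁ k₂ k₃ k₄ : ℕ}
    (q : Fin (k₃ + k₄ + 1) → ℝ)
    (ν₁ ν₂ : (Fin (k₁ + k₂ + 1) → ℝ) →ᵃ[ℝ] XLamPoly d) (ν₃ : XLamPoly d) : Prop where
  den_ne_zero : ∀ x₁ x₂ : ℝ, x₁ ^ 2 + x₂ ^ 2 = 1 → ∀ lam ∈ stdSimplex ℝ (Fin d),
    ν₃.at x₁ x₂ lam ≠ 0
  eq_fraction : ∀ l : Fin (k₁ + k₂ + 1) → ℝ,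
    ∀ x₁ x₂ : ℝ, x₁ ^ 2 + x₂ ^ 2 = 1 → ∀ lam ∈ stdSimplex ℝ (Fin d),
    errorTF P q l ((x₁ : ℂ) + Complex.I * (x₂ : ℂ)) lam =
      (((ν₁ l).at x₁ x₂ lam : ℂ) + Complex.I * ((ν₂ l).at x₁ x₂ lam : ℂ)) /
        (ν₃.at x₁ x₂ lam : ℂ)

/-- The 3 x 3 matrix polynomial `T`, for given values of `γ` and of the polynomials. -/
def matT {d : ℕ} (γ : ℝ) (ν₁ ν₂ ν₃ : XLamPoly d) : Matrix (Fin 3) (Fin 3) (XLamPoly d) :=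
  !![C (γ ^ 2) * ν₃ ^ 2, ν₁, ν₂;
     ν₁, 1, 0;
     ν₂, 0, 1]

/-- Degree of the exponent vector `s` in `(x₁, x₂)`. -/
def expDegX {d : ℕ} (s : (Fin 2 ⊕ Fin d) →₀ ℕ) : ℕ := ∑ i : Fin 2, s (Sum.inl i)

/-- Degree of the exponent vector `s` in `lam`. -/
def expDegLam {d : ℕ} (s : (Fin 2 ⊕ Fin d) →₀ ℕ) : ℕ := ∑ i : Fin d, s (Sum.inr i)

/-- Degree in `(x₁, x₂)` of a matrix polynomial: the maximum over its entries. -/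
def degX {d : ℕ} (M : Matrix (Fin 3) (Fin 3) (XLamPoly d)) : ℕ :=
  Finset.univ.sup fun i => Finset.univ.sup fun j => (M i j).support.sup expDegX

/-- Degree in `lam` of a matrix polynomial: the maximum over its entries. -/
def degLam {d : ℕ} (M : Matrix (Fin 3) (Fin 3) (XLamPoly d)) : ℕ :=
  Finset.univ.sup fun i => Finset.univ.sup fun j => (M i j).support.sup expDegLam

/-- Homogenization of a polynomial in `lam` to the degree `D` (at least its degree in `lam`):
each monomial is multiplied by the suitable power of `lam_1 + ... + lam_d`. -/
def homPoly {d : ℕ} (D : ℕ) (p : XLamPoly d) : XLamPoly d :=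
  ∑ s ∈ p.support, monomial s (coeff s p) * (∑ i : Fin d, X (Sum.inr i)) ^ (D - expDegLam s)

/-- Homogenization of a matrix polynomial in `lam`, to its degree in `lam`. -/
def homMat {d : ℕ} (M : Matrix (Fin 3) (Fin 3) (XLamPoly d)) :
    Matrix (Fin 3) (Fin 3) (XLamPoly d) :=
  M.map (homPoly (degLam M))

/-- From `T` to the matrix function
`T̂(x, lam) = hom(T)((1 - x²) / (1 + x²), 2 x / (1 + x²), lam)`. -/
def hatMat {d : ℕ} (M : Matrix (Fin 3) (Fin 3) (XLamPoly d)) (x : ℝ) (lam : Fin d → ℝ) :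
    Matrix (Fin 3) (Fin 3) ℝ :=
  (homMat M).map fun p => p.at ((1 - x ^ 2) / (1 + x ^ 2)) (2 * x / (1 + x ^ 2)) lam

/-- The vector of squares. -/
def sqVec {d : ℕ} (lam : Fin d → ℝ) : Fin d → ℝ := fun i => lam i ^ 2

/-- The Euclidean norm of a vector. -/
def l2norm {d : ℕ} (lam : Fin d → ℝ) : ℝ := ‖(WithLp.toLp 2 lam : EuclideanSpace ℝ (Fin d))‖

/-- A matrix polynomial is SOS if it is a finite sum of terms `Fᵀ F` with matrix polynomials
`F`. -/
def IsSOS {σ : Type*} (M : Matrix (Fin 3) (Fin 3) (MvPolynomial σ ℝ)) : Prop :=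
  ∃ (r : ℕ) (F : Fin r → Matrix (Fin 3) (Fin 3) (MvPolynomial σ ℝ)),
    M = ∑ i, (F i).transpose * F i

/-- A matrix function of `(x, lam)` is an SOS matrix polynomial: it is the function of a
(necessarily unique) matrix polynomial in `(x, lam)`, and this matrix polynomial is SOS. -/
def IsSOSMatrixPolynomial {d : ℕ} (f : ℝ → (Fin d → ℝ) → Matrix (Fin 3) (Fin 3) ℝ) : Prop :=
  ∃ M : Matrix (Fin 3) (Fin 3) (MvPolynomial (Unit ⊕ Fin d) ℝ),
    (∀ x lam, f x lam = M.map (eval (Sum.elim (fun _ => x) lam))) ∧ IsSOS M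

end

/-!
The equivalence between robust performance and a sum of squares certificate rests on three facts.

*Positivity of `T`.* Since `T` has the unit matrix as its lower right block, its quadratic form is
`(γ² ν₃² - ν₁² - ν₂²) v₀² + (v₁ + ν₁ v₀)² + (v₂ + ν₂ v₀)²` (`matT_quadratic_form`). So the bound
on the error transfer function at `z = x₁ + j x₂` and `lam` says precisely that `T` is positive
definite there. A certificate bounds `T` from below by `ε` at every point of the circle that the
rational parametrization reaches, and at the remaining point by continuity
(`lower_bound_of_isSOSMatrixPolynomial`).

*Pólya's theorem with a parameter.* For the converse, multiply the homogenized `T - ε` by a high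
power of `∑ lam`. The coefficient of `lam ^ β`, with `|β| = n`, is a multinomial coefficient times
a matrix that depends continuously on `(x₁, x₂)`, `y = β / n` and `t = 1 / n`, up to `t = 0`, where
it is `T - ε` itself at the point `y` of the simplex (`homPoly_at_mul_sum_pow`). As the circle and
the simplex are compact, all these coefficients are positive definite on the whole circle once `n`
is large (`exists_lower_bound_polyaValue`).

*Positive definite matrix polynomials in one variable are sums of squares.* After the rational
parametrization, each coefficient, multiplied by `(1 + x²) ^ deg(T, x)`, is such a polynomial in
`x`, and replacing `lam` by its vector of squares makes `lam ^ β` a square. For the univariate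
statement (`Polynomial.exists_sum_of_squares_of_posDef`), a Schur complement reduces the size of
the matrix at the price of a scalar denominator. The denominator is removed from the Hermitian
square `Bᴴ B` one pair of conjugate zeros `z`, `conj z` at a time: multiplication of `B` on the left
by a suitable rational function that is unitary on the real line makes `B` divisible by `X - z`
(`Polynomial.exists_hermitian_square_of_linear_factor`).

The existence of a fraction form is a computation in the algebra of complex polynomial functions on
the circle times the simplex, which is closed under conjugation and hence contains the negative
powers of `z` (`exists_isFractionForm`).
-/

/-! ### Sums of squares of matrix polynomials in one variable -/

/-- Complex polynomials with the involution that conjugates the coefficients and fixes the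
variable; on the real line it is pointwise complex conjugation. The conjugate transpose `Bᴴ` of a
matrix polynomial is understood with respect to it. -/
noncomputable abbrev complexPolynomialStarRing : StarRing (Polynomial ℂ) where
  star p := p.map (starRingEnd ℂ)
  star_involutive p := by simp [Polynomial.map_map]
  star_mul p q := by simp [mul_comm]
  star_add p q := by simp

namespace Polynomial

open Matrix

attribute [local instance] complexPolynomialStarRing

variable {m n : Type*}

theorem star_X_sub_C (z : ℂ) : star (X - C z) = X - C (star z) := by
  change Polynomial.map _ _ = _
  simp

theorem star_polynomial_map_ofReal (p : ℝ[X]) :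
    star (p.map Complex.ofRealHom) = p.map Complex.ofRealHom := by
  change Polynomial.map _ _ = _
  rw [Polynomial.map_map]
  congr 1
  ext x
  simp

theorem eval_star_polynomial (p : ℂ[X]) (z : ℂ) : (star p).eval z = star (p.eval (star z)) := by
  change (Polynomial.map _ _).eval z = _
  conv_lhs => rw [← star_star z]
  exact (Polynomial.eval_map_apply (f := starRingEnd ℂ) (p := p) (star z))

theorem conjTranspose_map_C (M : Matrix m m ℂ) :
    (M.map (C : ℂ →+* ℂ[X]))ᴴ = Mᴴ.map (C : ℂ →+* ℂ[X]) := by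
  ext1 i j
  change Polynomial.map (starRingEnd ℂ) (C (M j i)) = C (star (M j i))
  simp

/-- If the columns of `V` are orthogonal to those of `W`, then the orthogonal projection onto the
column space of `V` fixes `V` and kills `W`. -/
theorem exists_orthogonal_projection_matrix [Fintype m] [DecidableEq m] [Fintype n]
    (V W : Matrix m n ℂ) (h : Wᴴ * V = 0) :
    ∃ E : Matrix m m ℂ, Eᴴ = E ∧ E * E = E ∧ E * V = V ∧ E * W = 0 := by
  classical
  set K := LinearMap.range (toEuclideanLin V) with hK
  set Φ := toEuclideanCLM (n := m) (𝕜 := ℂ)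
  have happ : ∀ x : EuclideanSpace ℂ m,
      WithLp.toLp 2 (Φ.symm K.starProjection *ᵥ x.ofLp) = K.starProjection x := by
    intro x
    have h1 := congrArg (fun f : EuclideanSpace ℂ m →L[ℂ] EuclideanSpace ℂ m => f x)
      (Φ.apply_symm_apply K.starProjection)
    rw [← h1]
    exact (toEuclideanCLM_toLp _ _).symm
  refine ⟨Φ.symm K.starProjection, ?_, ?_, ?_, ?_⟩
  · refine (EquivLike.injective Φ) ?_
    have h1 : Φ (star (Φ.symm K.starProjection)) = star (Φ (Φ.symm K.starProjection)) :=
      map_star Φ _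
    rw [← star_eq_conjTranspose, h1, Φ.apply_symm_apply]
    exact isSelfAdjoint_starProjection K
  · rw [← map_mul]
    exact congrArg _ K.isIdempotentElem_starProjection
  · refine Matrix.ext_of_mulVec_single fun j => ?_
    have h2 : K.starProjection (toEuclideanLin V (WithLp.toLp 2 (Pi.single j 1))) =
        toEuclideanLin V (WithLp.toLp 2 (Pi.single j 1)) :=
      Submodule.starProjection_eq_self_iff.2 ⟨_, rfl⟩
    rw [← happ] at h2
    rw [← mulVec_mulVec]
    exact congrArg WithLp.ofLp h2
  · refine Matrix.ext_of_mulVec_single fun j => ?_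
    have h2 : K.starProjection (toEuclideanLin W (WithLp.toLp 2 (Pi.single j 1))) = 0 := by
      rw [Submodule.starProjection_apply_eq_zero_iff, Submodule.mem_orthogonal]
      rintro _ ⟨x, rfl⟩
      have h3 : Vᴴ * W = 0 := by simpa using congrArg conjTranspose h
      rw [EuclideanSpace.inner_eq_star_dotProduct, ofLp_toLpLin, ofLp_toLpLin,
        toLin'_apply, toLin'_apply, star_mulVec, dotProduct_comm, ← dotProduct_mulVec,
        mulVec_mulVec, h3, zero_mulVec, dotProduct_zero]
    rw [← happ] at h2
    rw [← mulVec_mulVec, zero_mulVec]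
    exact congrArg WithLp.ofLp h2

theorem map_eval_mul {k R : Type*} [CommRing R] [Fintype m] (w : R) (M : Matrix k m R[X])
    (N : Matrix m n R[X]) : (M * N).map (eval w) = M.map (eval w) * N.map (eval w) :=
  Matrix.map_mul (f := evalRingHom w)

theorem exists_eq_X_sub_C_smul (z : ℂ) (B : Matrix m n ℂ[X]) (h : B.map (eval z) = 0) :
    ∃ D : Matrix m n ℂ[X], B = (X - C z) • D := by
  have h' : ∀ i j, ∃ p : ℂ[X], B i j = (X - C z) * p := fun i j => by
    have := congrFun (congrFun h i) j
    exact dvd_iff_isRoot.2 this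
  choose D hD using h'
  exact ⟨Matrix.of D, Matrix.ext fun i j => hD i j⟩

theorem smul_matrix_left_cancel {R : Type*} [CommRing R] [IsDomain R] {p : R} (hp : p ≠ 0)
    {A B : Matrix m n R} (h : p • A = p • B) : A = B := by
  ext i j
  exact mul_left_cancel₀ hp (congrFun (congrFun h i) j)

/-- A denominator `(X - z) (X - conj z)` can be removed from a Hermitian square. At `z` the
relation says that the ranges of `B(z)` and `B(conj z)` are orthogonal. With `E` the projection
onto the range of `B(z)`, multiply `B` on the left by the rational function
`(1 - E) + (X - z) / (X - conj z) E`, which is unitary on the real line: the product is still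
polynomial, and vanishes at `z`. -/
theorem exists_hermitian_square_of_linear_factor [Fintype m] [DecidableEq m] [Fintype n]
    (z : ℂ) (A : Matrix n n ℂ[X])
    (B : Matrix m n ℂ[X]) (h : ((X - C z) * (X - C (star z))) • A = Bᴴ * B) :
    ∃ B' : Matrix m n ℂ[X], A = B'ᴴ * B' := by
  have hz : (X - C z : ℂ[X]) ≠ 0 := X_sub_C_ne_zero z
  have hz' : (X - C (star z) : ℂ[X]) ≠ 0 := X_sub_C_ne_zero _
  obtain ⟨E, hE, hEE, hEV, hEW⟩ := exists_orthogonal_projection_matrix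
    (B.map (eval z)) (B.map (eval (star z))) (by
      have h1 : (Bᴴ).map (eval z) = (B.map (eval (star z)))ᴴ := by
        ext i j
        simp [eval_star_polynomial]
      rw [← h1, ← map_eval_mul, ← h]
      ext i j
      simp)
  have hcc : ∀ w, (E.map (C : ℂ →+* ℂ[X])).map (eval w) = E := fun w => by ext; simp
  set P : Matrix m m ℂ[X] := E.map (C : ℂ →+* ℂ[X]) with hP
  have hPH : Pᴴ = P := by rw [hP, conjTranspose_map_C, hE]
  have hPP : P * P = P := by rw [hP, ← Matrix.map_mul, hEE]
  obtain ⟨D, hD⟩ := exists_eq_X_sub_C_smul (star z) (P * B) (by rw [map_eval_mul, hcc, hEW])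
  obtain ⟨B', hB'⟩ := exists_eq_X_sub_C_smul z (B - P * B + (X - C z) • D) (by
    have : (B - P * B).map (eval z) = 0 := by
      rw [Matrix.map_sub _ (by simp), map_eval_mul, hcc, hEV, sub_self]
    ext i j
    have := congrFun (congrFun this i) j
    rw [map_apply] at this ⊢
    rw [Matrix.add_apply, eval_add, this]
    simp)
  refine ⟨B', ?_⟩
  -- the cross terms vanish because `1 - E` and `E` project onto orthogonal spaces
  have hcross : (B - P * B)ᴴ * D = 0 := by
    refine smul_matrix_left_cancel hz' ?_
    rw [← Matrix.mul_smul, ← hD, conjTranspose_sub, conjTranspose_mul, hPH, Matrix.sub_mul,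
      Matrix.mul_assoc Bᴴ, ← Matrix.mul_assoc P, hPP, sub_self, smul_zero]
  have hcross' : Dᴴ * (B - P * B) = 0 := by
    simpa using congrArg conjTranspose hcross
  have hDD : ((X - C z) * (X - C (star z))) • (Dᴴ * D) = Bᴴ * (P * B) := by
    have : (P * B)ᴴ * (P * B) = Bᴴ * (P * B) := by
      rw [conjTranspose_mul, hPH, Matrix.mul_assoc, ← Matrix.mul_assoc P, hPP]
    rw [← this, hD, conjTranspose_smul, star_X_sub_C, star_star, Matrix.smul_mul, Matrix.mul_smul,
      smul_smul]
  have hrest : (B - P * B)ᴴ * (B - P * B) = Bᴴ * B - Bᴴ * (P * B) := by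
    rw [conjTranspose_sub, conjTranspose_mul, hPH]
    simp only [Matrix.sub_mul, Matrix.mul_sub, Matrix.mul_assoc]
    rw [← Matrix.mul_assoc P P B, hPP]
    abel
  refine smul_matrix_left_cancel (mul_ne_zero hz hz') ?_
  have key := congrArg (fun M : Matrix m n ℂ[X] => Mᴴ * M) hB'
  simp only [conjTranspose_add, conjTranspose_smul, star_X_sub_C, Matrix.add_mul, Matrix.mul_add,
    Matrix.smul_mul, Matrix.mul_smul, hcross, hcross', hrest, smul_zero, smul_smul] at key
  rw [smul_add, smul_smul, hDD] at key
  rw [h, ← key, smul_zero]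
  abel

/-- A polynomial without real zeros that is positive on the real line can be removed as a
denominator of a Hermitian square, one pair of conjugate zeros at a time. -/
theorem exists_hermitian_square_of_pos_smul [Fintype m] [DecidableEq m] [Fintype n]
    (w : ℝ[X]) (hw : ∀ x, 0 < w.eval x)
    (A : Matrix n n ℂ[X]) (B : Matrix m n ℂ[X])
    (h : w.map Complex.ofRealHom • A = Bᴴ * B) : ∃ B' : Matrix m n ℂ[X], A = B'ᴴ * B' := by
  induction hN : w.natDegree using Nat.strong_induction_on generalizing w A B with
  | _ N ih =>
  by_cases hdeg : w.natDegree = 0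
  · obtain ⟨c, rfl⟩ := natDegree_eq_zero.1 hdeg
    have hc : 0 < c := by simpa using hw 0
    refine ⟨(C ((Real.sqrt c)⁻¹ : ℂ) : ℂ[X]) • B, ?_⟩
    have hs : star (C ((Real.sqrt c : ℂ)⁻¹) : ℂ[X]) = C ((Real.sqrt c : ℂ)⁻¹) := by
      change Polynomial.map _ _ = _
      simp
    rw [conjTranspose_smul, hs, Matrix.smul_mul, Matrix.mul_smul, smul_smul, ← h, smul_smul,
      ← C_mul]
    simp only [Polynomial.map_C, ← C_mul]
    have : ((Real.sqrt c : ℂ)⁻¹ * (Real.sqrt c : ℂ)⁻¹ * Complex.ofRealHom c) = 1 := by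
      rw [← mul_inv, ← Complex.ofReal_mul, Real.mul_self_sqrt hc.le]
      exact inv_mul_cancel₀ (by exact_mod_cast hc.ne')
    rw [this]
    simp
  · obtain ⟨z, hz⟩ := IsAlgClosed.exists_aeval_eq_zero ℂ w
      (fun h0 => hdeg (natDegree_eq_of_degree_eq_some h0))
    have him : z.im ≠ 0 := by
      intro him
      have hz' : z = (z.re : ℂ) := by apply Complex.ext <;> simp [him]
      rw [hz'] at hz
      have : ((w.eval z.re : ℝ) : ℂ) = 0 := by
        rw [← hz, ← Complex.coe_algebraMap, aeval_algebraMap_apply]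
        simp
      exact (hw z.re).ne' (by exact_mod_cast this)
    obtain ⟨w', rfl⟩ := w.quadratic_dvd_of_aeval_eq_zero_im_ne_zero hz him
    have hq : (X ^ 2 - C (2 * z.re) * X + C (‖z‖ ^ 2) : ℝ[X]).map Complex.ofRealHom =
        (X - C z) * (X - C (star z)) := by
      have h1 : (C ((2 * z.re : ℝ) : ℂ) : ℂ[X]) = C z + C (star z) := by
        rw [← C_add]
        congr 1
        exact (Complex.add_conj z).symm
      have h2 : (C ((‖z‖ ^ 2 : ℝ) : ℂ) : ℂ[X]) = C z * C (star z) := by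
        rw [← C_mul]
        congr 1
        rw [Complex.ofReal_pow]
        exact (Complex.mul_conj' z).symm
      simp only [Polynomial.map_add, Polynomial.map_sub, Polynomial.map_mul, Polynomial.map_pow,
        map_X, Polynomial.map_C, Complex.ofRealHom_eq_coe, h1, h2]
      ring
    have hqpos : ∀ x : ℝ, 0 < (X ^ 2 - C (2 * z.re) * X + C (‖z‖ ^ 2) : ℝ[X]).eval x := by
      intro x
      have h3 : ‖z‖ ^ 2 = z.re ^ 2 + z.im ^ 2 := by
        rw [← Complex.normSq_eq_norm_sq, Complex.normSq_apply]; ring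
      simp only [eval_add, eval_sub, eval_mul, eval_pow, eval_X, eval_C, h3]
      nlinarith [sq_nonneg (x - z.re), sq_pos_of_ne_zero him]
    have hw' : ∀ x, 0 < w'.eval x := fun x => by
      have := hw x
      rw [eval_mul] at this
      exact pos_of_mul_pos_right this (hqpos x).le
    rw [Polynomial.map_mul, hq, mul_smul] at h
    obtain ⟨B₁, hB₁⟩ := exists_hermitian_square_of_linear_factor z _ B h
    refine ih w'.natDegree ?_ w' hw' A B₁ hB₁ rfl
    have hw0 : w' ≠ 0 := fun h0 => by simpa [h0] using hw' 0
    have hqdeg : (X ^ 2 - C (2 * z.re) * X + C (‖z‖ ^ 2) : ℝ[X]).natDegree = 2 := by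
      compute_degree!
    have hq0 : (X ^ 2 - C (2 * z.re) * X + C (‖z‖ ^ 2) : ℝ[X]) ≠ 0 := fun h0 => by
      rw [h0] at hqdeg
      simp at hqdeg
    rw [← hN, natDegree_mul hq0 hw0, hqdeg]
    omega

/-- Hermitian square factorization of a positive definite matrix polynomial. With `a` the upper
left entry and `S` the polynomial Schur complement, `a A` is the square of the first row plus `S`,
which is a Hermitian square by induction; then the denominator `a` is removed. -/
theorem exists_hermitian_square_of_posDef {n : ℕ} (A : Matrix (Fin n) (Fin n) ℝ[X])
    (hA : ∀ i j, A i j = A j i)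
    (hpos : ∀ x : ℝ, ∀ v : Fin n → ℝ, v ≠ 0 → 0 < ∑ i, ∑ j, v i * (A i j).eval x * v j) :
    ∃ (m : ℕ) (B : Matrix (Fin m) (Fin n) ℂ[X]), A.map (map Complex.ofRealHom) = Bᴴ * B := by
  induction n with
  | zero => exact ⟨0, 0, by ext i; exact i.elim0⟩
  | succ n ih =>
    have ha : ∀ x, 0 < (A 0 0).eval x := fun x => by
      have := hpos x (Pi.single 0 1) (by simp)
      simpa [Fin.sum_univ_succ, Fin.succ_ne_zero] using this
    obtain ⟨m, B, hB⟩ := ih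
      (Matrix.of fun i j => A 0 0 * A i.succ j.succ - A 0 i.succ * A 0 j.succ)
      (fun i j => by simp [hA i.succ j.succ, mul_comm])
      (fun x w hw => by
        -- with `a, r` the first row, the vector `(-(r ⬝ w), a w)` gives `a` times the
        -- quadratic form of the Schur complement at `w`
        have h1 := hpos x (Fin.cons (-∑ j, (A 0 j.succ).eval x * w j)
          (fun i => (A 0 0).eval x * w i)) (by
            intro h0
            refine hw ?_
            ext i
            have := congrFun h0 i.succ
            simpa [(ha x).ne'] using this)
        set s := ∑ j, (A 0 j.succ).eval x * w j with hs
        set a := (A 0 0).eval x with ha'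
        have h2 : ∑ i : Fin n, ∑ j : Fin n, w i * (a * (A i.succ j.succ).eval x -
            (A 0 i.succ).eval x * (A 0 j.succ).eval x) * w j =
            a * (∑ i : Fin n, ∑ j : Fin n, w i * (A i.succ j.succ).eval x * w j) - s * s := by
          rw [hs, Finset.sum_mul_sum, Finset.mul_sum, ← Finset.sum_sub_distrib]
          refine Finset.sum_congr rfl fun i _ => ?_
          rw [Finset.mul_sum, ← Finset.sum_sub_distrib]
          refine Finset.sum_congr rfl fun j _ => ?_
          ring
        have h3 : (∑ i : Fin (n + 1), ∑ j : Fin (n + 1),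
            (Fin.cons (-s) (fun i => a * w i) : Fin (n + 1) → ℝ) i * (A i j).eval x *
              (Fin.cons (-s) (fun i => a * w i) : Fin (n + 1) → ℝ) j) =
            a * (a * (∑ i : Fin n, ∑ j : Fin n, w i * (A i.succ j.succ).eval x * w j)
              - s * s) := by
          rw [Fin.sum_univ_succ]
          simp only [Fin.sum_univ_succ, Fin.cons_zero, Fin.cons_succ, ← ha']
          have h4 : ∑ j : Fin n, -s * (A 0 j.succ).eval x * (a * w j) = -s * a * s := by
            conv_rhs => rw [hs, Finset.mul_sum]
            exact Finset.sum_congr rfl fun j _ => by ring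
          have h5 : ∑ i : Fin n, a * w i * (A i.succ 0).eval x * -s = -s * a * s := by
            conv_rhs => rw [hs, Finset.mul_sum]
            exact Finset.sum_congr rfl fun j _ => by rw [hA j.succ 0]; ring
          have h6 : ∑ i : Fin n, ∑ j : Fin n, a * w i * (A i.succ j.succ).eval x * (a * w j) =
              a * (a * ∑ i : Fin n, ∑ j : Fin n, w i * (A i.succ j.succ).eval x * w j) := by
            simp only [Finset.mul_sum]
            exact Finset.sum_congr rfl fun i _ => Finset.sum_congr rfl fun j _ => by ring
          rw [Finset.sum_add_distrib, h4, h5, h6]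
          ring
        rw [h3] at h1
        simp only [Matrix.of_apply, eval_sub, eval_mul, ← ha']
        rw [h2]
        exact pos_of_mul_pos_right h1 (ha x).le)
    obtain ⟨B', hB'⟩ := exists_hermitian_square_of_pos_smul (A 0 0) ha
      (A.map (map Complex.ofRealHom))
      (Matrix.of (Fin.cons (fun j => (A 0 j).map Complex.ofRealHom)
        fun k => Fin.cons 0 (B k) : Fin (m + 1) → Fin (n + 1) → ℂ[X])) (by
        ext1 i j
        rw [Matrix.smul_apply, Matrix.mul_apply, Fin.sum_univ_succ]
        simp only [map_apply, conjTranspose_apply, of_apply, Fin.cons_zero, Fin.cons_succ,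
          star_polynomial_map_ofReal, smul_eq_mul]
        refine Fin.cases ?_ (fun i => ?_) i
        · simp
        · refine Fin.cases ?_ (fun j => ?_) j
          · simp [hA i.succ 0, mul_comm]
          · have := congrFun (congrFun hB i) j
            rw [Matrix.mul_apply] at this
            simp only [map_apply, of_apply, conjTranspose_apply, Polynomial.map_sub,
              Polynomial.map_mul] at this
            simp only [Fin.cons_succ, ← this]
            ring)
    exact ⟨m + 1, B', hB'⟩

theorem exists_eq_real_add_I_mul_real (p : ℂ[X]) :
    ∃ u v : ℝ[X], p = u.map Complex.ofRealHom + C Complex.I * v.map Complex.ofRealHom := by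
  induction p using Polynomial.induction_on' with
  | add p q hp hq =>
    obtain ⟨u, v, rfl⟩ := hp
    obtain ⟨u', v', rfl⟩ := hq
    exact ⟨u + u', v + v', by simp only [Polynomial.map_add]; ring⟩
  | monomial k a =>
    refine ⟨monomial k a.re, monomial k a.im, ?_⟩
    rw [map_monomial, map_monomial, C_mul_monomial, ← map_add]
    congr 1
    rw [mul_comm]
    exact (Complex.re_add_im a).symm

/-- A positive definite real matrix polynomial in one variable is a sum of squares, here written
as a sum of rank one matrix polynomials; these come from the real and imaginary parts of the rows of
a complex factor. -/
theorem exists_sum_of_squares_of_posDef {n : ℕ} (A : Matrix (Fin n) (Fin n) ℝ[X])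
    (hA : ∀ i j, A i j = A j i)
    (hpos : ∀ x : ℝ, ∀ v : Fin n → ℝ, v ≠ 0 → 0 < ∑ i, ∑ j, v i * (A i j).eval x * v j) :
    ∃ (m : ℕ) (f : Fin m ⊕ Fin m → Fin n → ℝ[X]), ∀ i j, A i j = ∑ k, f k i * f k j := by
  obtain ⟨m, B, hB⟩ := exists_hermitian_square_of_posDef A hA hpos
  choose u v huv using fun k i => exists_eq_real_add_I_mul_real (B k i)
  refine ⟨m, Sum.elim u v, fun i j => Polynomial.funext fun x => ?_⟩
  have h1 := congrArg (eval (x : ℂ)) (congrFun (congrFun hB i) j)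
  rw [Matrix.mul_apply] at h1
  have hev : ∀ p : ℝ[X], (p.map Complex.ofRealHom).eval (x : ℂ) = ((p.eval x : ℝ) : ℂ) :=
    fun p => eval_map_apply (f := Complex.ofRealHom) (p := p) x
  have hBx : ∀ k i, (B k i).eval (x : ℂ) =
      (((u k i).eval x : ℝ) : ℂ) + Complex.I * (((v k i).eval x : ℝ) : ℂ) := fun k i => by
    rw [huv k i, eval_add, eval_mul, eval_C, hev, hev]
  simp only [map_apply, conjTranspose_apply, eval_finsetSum, eval_mul, eval_star_polynomial,
    hev] at h1
  have h2 : star (x : ℂ) = x := Complex.conj_ofReal x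
  simp only [h2, hBx] at h1
  have h3 := congrArg Complex.re h1
  simp only [Complex.ofReal_re, Complex.re_sum] at h3
  rw [h3, Fintype.sum_sum_type, eval_add, eval_finsetSum, eval_finsetSum,
    ← Finset.sum_add_distrib]
  refine Finset.sum_congr rfl fun k _ => ?_
  simp [Complex.mul_re]

end Polynomial

/-! ### Pólya's theorem with a compact parameter -/

section Polya

open Finset Filter Topology

variable {d : ℕ}

theorem cast_descFactorial_eq_prod (b a : ℕ) :
    (b.descFactorial a : ℝ) = ∏ r ∈ range a, ((b : ℝ) - r) := by
  rw [← descPochhammer_eval_eq_descFactorial, descPochhammer_eval_eq_prod_range]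

/-- The weight with which the monomial of exponent `β` occurs in `μ ^ α (∑ μ) ^ (n - |α|)`,
relative to `(∑ μ) ^ n`, as a function of `y = β / n` and `t = 1 / n`. The point of this form is
that it extends continuously to `t = 0`, where it is the monomial `y ^ α`. -/
noncomputable def polyaWeight (α : Fin d → ℕ) (y : Fin d → ℝ) (t : ℝ) : ℝ :=
  (∏ i, ∏ r ∈ range (α i), (y i - r * t)) / ∏ r ∈ range (∑ i, α i), (1 - r * t)

theorem polyaWeight_zero (α : Fin d → ℕ) (y : Fin d → ℝ) :
    polyaWeight α y 0 = ∏ i, y i ^ α i := by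
  simp [polyaWeight]

theorem prod_range_div_sub (b a n : ℕ) :
    ∏ r ∈ range a, ((b : ℝ) / n - r * (1 / n)) = (b.descFactorial a : ℝ) / n ^ a := by
  have : (n : ℝ) ^ a = ∏ _r ∈ range a, (n : ℝ) := by simp
  rw [cast_descFactorial_eq_prod, this, ← prod_div_distrib]
  exact prod_congr rfl fun r _ => by ring

theorem polyaWeight_eq (α β : Fin d → ℕ) (n : ℕ) (hn : 0 < n) :
    polyaWeight α (fun i => (β i : ℝ) / n) (1 / n) =
      (∏ i, ((β i).descFactorial (α i) : ℝ)) / (n.descFactorial (∑ i, α i) : ℝ) := by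
  have hn' : (n : ℝ) ≠ 0 := by positivity
  have h1 := prod_range_div_sub n (∑ i, α i) n
  rw [div_self hn'] at h1
  rw [polyaWeight, h1]
  simp only [prod_range_div_sub _ _ n, prod_div_distrib, prod_pow_eq_pow_sum]
  rw [div_div_div_cancel_right₀ (pow_ne_zero _ hn')]

theorem continuousAt_polyaWeight (α : Fin d → ℕ) (y : Fin d → ℝ) :
    ContinuousAt (fun p : ℝ × (Fin d → ℝ) => polyaWeight α p.2 p.1) (0, y) := by
  unfold polyaWeight
  refine ContinuousAt.div (Continuous.continuousAt (by fun_prop))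
    (Continuous.continuousAt (by fun_prop)) (by simp)

theorem prod_pow_mul_sum_pow (α : Fin d → ℕ) (n : ℕ) (hn : 0 < n) (hα : ∑ i, α i ≤ n)
    (μ : Fin d → ℝ) :
    (∏ i, μ i ^ α i) * (∑ i, μ i) ^ (n - ∑ i, α i) =
      ∑ β ∈ piAntidiag univ n, (Nat.multinomial univ β : ℝ) *
        polyaWeight α (fun i => (β i : ℝ) / n) (1 / n) * ∏ i, μ i ^ β i := by
  have hD : (n.descFactorial (∑ i, α i) : ℝ) ≠ 0 := by
    exact_mod_cast (Nat.descFactorial_pos.2 hα).ne'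
  rw [sum_pow_eq_sum_piAntidiag, mul_sum]
  refine sum_of_injOn (fun δ => α + δ) (fun _ _ _ _ h => add_left_cancel h) ?_ ?_ ?_
  · intro δ hδ
    rw [mem_coe, mem_piAntidiag] at hδ ⊢
    have h1 : ∑ i, δ i = n - ∑ i, α i := hδ.1
    refine ⟨?_, by simp⟩
    change ∑ i, (α i + δ i) = n
    rw [sum_add_distrib, h1]
    omega
  · -- exponents `β` that do not dominate `α` have weight zero
    intro β hβ hβ'
    rw [polyaWeight_eq _ _ _ hn]
    by_cases hle : α ≤ β
    · refine absurd ⟨β - α, ?_, add_tsub_cancel_of_le hle⟩ hβ'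
      have h1 : ∑ i, (β - α) i + ∑ i, α i = ∑ i, β i := by
        rw [← sum_add_distrib]
        exact sum_congr rfl fun i _ => tsub_add_cancel_of_le (hle i)
      rw [mem_piAntidiag] at hβ
      rw [mem_coe, mem_piAntidiag]
      refine ⟨?_, by simp⟩
      have h2 : ∑ i, β i = n := hβ.1
      change ∑ i, (β - α) i = _
      omega
    · obtain ⟨i, hi⟩ := not_forall.1 hle
      rw [prod_eq_zero (mem_univ i)]
      · simp
      · exact_mod_cast Nat.descFactorial_eq_zero_iff_lt.2 (not_le.1 hi)
  · intro δ hδ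
    rw [mem_piAntidiag] at hδ
    have h1 : (∏ i, ((δ i).factorial : ℝ)) * Nat.multinomial univ δ =
        ((n - ∑ i, α i).factorial : ℝ) := by
      exact_mod_cast (Nat.multinomial_spec univ δ).trans (by rw [hδ.1])
    have h2 : (∏ i, (((α + δ) i).factorial : ℝ)) * Nat.multinomial univ (α + δ) =
        (n.factorial : ℝ) := by
      have : ∑ i, (α + δ) i = n := by
        have h3 : ∑ i, δ i = n - ∑ i, α i := hδ.1
        simp only [Pi.add_apply, sum_add_distrib]
        omega
      exact_mod_cast (Nat.multinomial_spec univ (α + δ)).trans (by rw [this])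
    have h3 : ((n - ∑ i, α i).factorial : ℝ) * (n.descFactorial (∑ i, α i) : ℝ) = n.factorial := by
      exact_mod_cast Nat.factorial_mul_descFactorial hα
    have h4 : (∏ i, ((δ i).factorial : ℝ)) * (∏ i, (((α + δ) i).descFactorial (α i) : ℝ)) =
        ∏ i, (((α + δ) i).factorial : ℝ) := by
      rw [← prod_mul_distrib]
      refine prod_congr rfl fun i _ => ?_
      have := Nat.factorial_mul_descFactorial (n := (α + δ) i) (k := α i) (by simp)
      rw [Pi.add_apply, Nat.add_sub_cancel_left] at this
      exact_mod_cast this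
    have h5 : (∏ i, ((δ i).factorial : ℝ)) ≠ 0 :=
      prod_ne_zero_iff.2 fun i _ => by exact_mod_cast (Nat.factorial_ne_zero _)
    have h6 : (Nat.multinomial univ δ : ℝ) = (Nat.multinomial univ (α + δ) : ℝ) *
        ((∏ i, (((α + δ) i).descFactorial (α i) : ℝ)) / (n.descFactorial (∑ i, α i) : ℝ)) := by
      rw [mul_div_assoc', eq_div_iff hD]
      refine mul_left_cancel₀ h5 ?_
      rw [← mul_assoc, h1, h3, ← h2, ← h4]
      ring
    have h7 : ∏ i, μ i ^ (α + δ) i = (∏ i, μ i ^ α i) * ∏ i, μ i ^ δ i := by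
      rw [← prod_mul_distrib]
      exact prod_congr rfl fun i _ => by rw [Pi.add_apply, pow_add]
    rw [polyaWeight_eq _ _ _ hn, ← h6, h7]
    ring

/-- The value of a polynomial in `(x₁, x₂, lam)` with each monomial in `lam` replaced by its
weight `polyaWeight`. -/
noncomputable def polyaValue (p : XLamPoly d) (x₁ x₂ : ℝ) (y : Fin d → ℝ) (t : ℝ) : ℝ :=
  ∑ s ∈ p.support, coeff s p * (x₁ ^ s (Sum.inl 0) * x₂ ^ s (Sum.inl 1)) *
    polyaWeight (fun i => s (Sum.inr i)) y t

theorem at_eq_sum (p : XLamPoly d) (x₁ x₂ : ℝ) (lam : Fin d → ℝ) :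
    p.at x₁ x₂ lam = ∑ s ∈ p.support, coeff s p *
      (x₁ ^ s (Sum.inl 0) * x₂ ^ s (Sum.inl 1)) * ∏ i, lam i ^ s (Sum.inr i) := by
  rw [XLamPoly.at, MvPolynomial.eval_eq']
  refine sum_congr rfl fun s _ => ?_
  rw [Fintype.prod_sum_type, Fin.prod_univ_two]
  simp [mul_assoc]

theorem polyaValue_zero (p : XLamPoly d) (x₁ x₂ : ℝ) (y : Fin d → ℝ) :
    polyaValue p x₁ x₂ y 0 = p.at x₁ x₂ y := by
  simp only [polyaValue, polyaWeight_zero, at_eq_sum]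

theorem continuousAt_polyaValue (p : XLamPoly d) (w : (ℝ × ℝ) × (Fin d → ℝ)) :
    ContinuousAt (fun z : ℝ × ((ℝ × ℝ) × (Fin d → ℝ)) =>
      polyaValue p z.2.1.1 z.2.1.2 z.2.2 z.1) (0, w) := by
  refine tendsto_finsetSum _ fun s _ => ?_
  refine Tendsto.mul (Continuous.tendsto' (by fun_prop) _ _ rfl) ?_
  exact (continuousAt_polyaWeight (fun i => s (Sum.inr i)) w.2).comp_of_eq
    (f := fun z : ℝ × ((ℝ × ℝ) × (Fin d → ℝ)) => (z.1, z.2.2)) (by fun_prop) rfl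

theorem homPoly_at (D : ℕ) (p : XLamPoly d) (x₁ x₂ : ℝ) (lam : Fin d → ℝ) :
    (homPoly D p).at x₁ x₂ lam = ∑ s ∈ p.support, coeff s p *
      (x₁ ^ s (Sum.inl 0) * x₂ ^ s (Sum.inl 1)) *
        ((∏ i, lam i ^ s (Sum.inr i)) * (∑ i, lam i) ^ (D - expDegLam s)) := by
  rw [XLamPoly.at, homPoly, map_sum]
  refine sum_congr rfl fun s _ => ?_
  rw [map_mul, map_pow, map_sum, eval_monomial, Finsupp.prod_fintype _ _ (by simp),
    Fintype.prod_sum_type, Fin.prod_univ_two]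
  simp [mul_assoc]

theorem homPoly_at_mul_sum_pow (D k : ℕ) (hn : 0 < k + D) (p : XLamPoly d)
    (hp : ∀ s ∈ p.support, expDegLam s ≤ D) (x₁ x₂ : ℝ) (lam : Fin d → ℝ) :
    (homPoly D p).at x₁ x₂ lam * (∑ i, lam i) ^ k =
      ∑ β ∈ piAntidiag univ (k + D), (Nat.multinomial univ β : ℝ) *
        polyaValue p x₁ x₂ (fun i => (β i : ℝ) / (k + D : ℕ)) (1 / (k + D : ℕ)) *
          ∏ i, lam i ^ β i := by
  simp only [polyaValue, mul_sum, sum_mul]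
  rw [sum_comm, homPoly_at, sum_mul]
  refine sum_congr rfl fun s hs => ?_
  have h1 := prod_pow_mul_sum_pow (fun i => s (Sum.inr i)) (k + D) hn
    ((hp s hs).trans (Nat.le_add_left _ _)) lam
  have h2 : k + D - ∑ i, s (Sum.inr i) = (D - expDegLam s) + k := by
    have := hp s hs
    rw [expDegLam] at this ⊢
    omega
  rw [mul_assoc, mul_assoc (∏ i, _), ← pow_add, ← h2, h1, mul_sum]
  exact sum_congr rfl fun β _ => by ring

/-- If the quadratic form of a matrix polynomial is positive definite for `(x₁, x₂)` on the unit
circle and `lam` in the simplex, then so are, for large `n` and with a uniform lower bound, the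
matrices that occur, up to multinomial coefficients, in the expansion of its product with a power of
`∑ lam`. By compactness it is enough to look at the limit `t = 1 / n → 0`. -/
theorem exists_lower_bound_polyaValue (M : Matrix (Fin 3) (Fin 3) (XLamPoly d))
    (hpos : ∀ x₁ x₂ : ℝ, x₁ ^ 2 + x₂ ^ 2 = 1 → ∀ y ∈ stdSimplex ℝ (Fin d),
      ∀ v : Fin 3 → ℝ, v ≠ 0 → 0 < ∑ i, ∑ j, v i * (M i j).at x₁ x₂ y * v j) :
    ∃ ε : ℝ, 0 < ε ∧ ∃ n₀ : ℕ, ∀ n ≥ n₀, ∀ x₁ x₂ : ℝ, x₁ ^ 2 + x₂ ^ 2 = 1 →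
      ∀ y ∈ stdSimplex ℝ (Fin d), ∀ v : Fin 3 → ℝ, v ≠ 0 →
        ε * ∑ i, v i ^ 2 < ∑ i, ∑ j, v i * polyaValue (M i j) x₁ x₂ y (1 / n) * v j := by
  set S : Set ((ℝ × ℝ) × (Fin d → ℝ)) :=
    {c : ℝ × ℝ | c.1 ^ 2 + c.2 ^ 2 = 1} ×ˢ stdSimplex ℝ (Fin d) with hS
  set V : Set (Fin 3 → ℝ) := {v | ∑ i, v i ^ 2 = 1} with hV
  have hcirc : IsCompact {c : ℝ × ℝ | c.1 ^ 2 + c.2 ^ 2 = 1} := by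
    refine (isCompact_Icc (a := ((-1 : ℝ), (-1 : ℝ))) (b := (1, 1))).of_isClosed_subset
      (isClosed_eq (by fun_prop) (by fun_prop)) fun c hc => ?_
    simp only [Set.mem_ofPred_eq] at hc
    exact ⟨⟨by nlinarith [sq_nonneg c.2], by nlinarith [sq_nonneg c.1]⟩,
      ⟨by nlinarith [sq_nonneg c.2], by nlinarith [sq_nonneg c.1]⟩⟩
  have hVc : IsCompact V := by
    refine (isCompact_Icc (a := fun _ : Fin 3 => (-1 : ℝ)) (b := fun _ => 1)).of_isClosed_subset
      (isClosed_eq (by fun_prop) (by fun_prop)) fun v hv => ?_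
    have h1 : ∀ i, v i ^ 2 ≤ 1 := fun i => by
      rw [← show ∑ i, v i ^ 2 = 1 from hv]
      exact single_le_sum (f := fun i => v i ^ 2) (fun j _ => sq_nonneg (v j)) (mem_univ i)
    exact ⟨fun i => by nlinarith [h1 i], fun i => by nlinarith [h1 i]⟩
  have hK : IsCompact (S ×ˢ V) := (hcirc.prod (isCompact_stdSimplex ℝ (Fin d))).prod hVc
  set q : ℝ → ((ℝ × ℝ) × (Fin d → ℝ)) × (Fin 3 → ℝ) → ℝ := fun t w =>
    ∑ i, ∑ j, w.2 i * polyaValue (M i j) w.1.1.1 w.1.1.2 w.1.2 t * w.2 j with hq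
  have hqc : ∀ w, ContinuousAt (fun z : ℝ × (((ℝ × ℝ) × (Fin d → ℝ)) × (Fin 3 → ℝ)) =>
      q z.1 z.2) (0, w) := by
    intro w
    refine tendsto_finsetSum _ fun i _ => tendsto_finsetSum _ fun j _ => ?_
    refine Tendsto.mul (Tendsto.mul (Continuous.tendsto' (by fun_prop) _ _ rfl) ?_)
      (Continuous.tendsto' (by fun_prop) _ _ rfl)
    exact (continuousAt_polyaValue (M i j) w.1).comp_of_eq
      (f := fun z : ℝ × (((ℝ × ℝ) × (Fin d → ℝ)) × (Fin 3 → ℝ)) => (z.1, z.2.1))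
      (by fun_prop) rfl
  have hq0 : ∀ w ∈ S ×ˢ V, 0 < q 0 w := by
    rintro ⟨⟨⟨x₁, x₂⟩, y⟩, v⟩ ⟨⟨hx, hy⟩, hv⟩
    simp only [hq, polyaValue_zero]
    refine hpos x₁ x₂ hx y hy v fun h0 => ?_
    simp [hV, h0] at hv
  obtain ⟨ε, hε, hεq⟩ : ∃ ε : ℝ, 0 < ε ∧ ∀ w ∈ S ×ˢ V, ε < q 0 w := by
    have hc : ContinuousOn (q 0) (S ×ˢ V) := fun w _ =>
      ((hqc w).comp_of_eq (f := fun w => ((0 : ℝ), w)) (by fun_prop) rfl).continuousWithinAt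
    rcases (S ×ˢ V).eq_empty_or_nonempty with he | hne
    · exact ⟨1, one_pos, by simp [he]⟩
    · obtain ⟨w₀, hw₀, hmin⟩ := hK.exists_isMinOn hne hc
      refine ⟨q 0 w₀ / 2, half_pos (hq0 w₀ hw₀), fun w hw => ?_⟩
      exact (half_lt_self (hq0 w₀ hw₀)).trans_le (hmin hw)
  have hev : ∀ᶠ t in 𝓝 (0 : ℝ), ∀ w ∈ S ×ˢ V, ε < q t w :=
    hK.eventually_forall_of_forall_eventually fun w hw =>
      (hqc w).eventually_const_lt (hεq w hw)
  obtain ⟨n₀, hn₀⟩ := eventually_atTop.1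
    ((tendsto_one_div_atTop_nhds_zero_nat (𝕜 := ℝ)).eventually hev)
  refine ⟨ε, hε, n₀, fun n hn x₁ x₂ hx y hy v hv => ?_⟩
  have hr : 0 < ∑ i, v i ^ 2 := by
    obtain ⟨i, hi⟩ := Function.ne_iff.1 hv
    exact sum_pos' (fun i _ => sq_nonneg _) ⟨i, mem_univ i, sq_pos_of_ne_zero hi⟩
  set r := Real.sqrt (∑ i, v i ^ 2) with hrdef
  have hrpos : 0 < r := Real.sqrt_pos.2 hr
  have hr2 : r ^ 2 = ∑ i, v i ^ 2 := Real.sq_sqrt hr.le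
  have h1 := hn₀ n hn ⟨⟨⟨x₁, x₂⟩, y⟩, fun i => v i / r⟩ ⟨⟨hx, hy⟩, by
    simp only [hV, Set.mem_ofPred_eq, div_pow, ← sum_div, ← hr2]
    exact div_self (by positivity)⟩
  have h2 : ∑ i, ∑ j, v i * polyaValue (M i j) x₁ x₂ y (1 / n) * v j =
      r ^ 2 * q (1 / n) ⟨⟨⟨x₁, x₂⟩, y⟩, fun i => v i / r⟩ := by
    simp only [hq, mul_sum]
    refine sum_congr rfl fun i _ => sum_congr rfl fun j _ => ?_
    field_simp
  rw [h2, ← hr2, mul_comm]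
  exact mul_lt_mul_of_pos_left h1 (by positivity)

end Polya

/-! ### Complex polynomial functions on the circle times the simplex -/

section FractionForm

variable {d : ℕ}

/-- The product of the unit circle, with coordinates `(x₁, x₂)`, and the simplex. -/
abbrev CircleSimplex (d : ℕ) : Type :=
  {w : (ℝ × ℝ) × (Fin d → ℝ) // w.1.1 ^ 2 + w.1.2 ^ 2 = 1 ∧ w.2 ∈ stdSimplex ℝ (Fin d)}

/-- The point `x₁ + j x₂` of the unit circle in the complex plane. -/
noncomputable def CircleSimplex.z (w : CircleSimplex d) : ℂ :=
  (w.1.1.1 : ℂ) + Complex.I * (w.1.1.2 : ℂ)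

/-- The function of a real polynomial on the circle times the simplex. -/
noncomputable def polyFunction (p : XLamPoly d) : CircleSimplex d → ℂ :=
  fun w => (p.at w.1.1.1 w.1.1.2 w.1.2 : ℂ)

/-- Complex-valued polynomial functions on the circle times the simplex. -/
def polyFunctions (d : ℕ) : Subalgebra ℂ (CircleSimplex d → ℂ) :=
  Algebra.adjoin ℂ (Set.range fun a : Fin 2 ⊕ Fin d => polyFunction (X a))

theorem polyFunction_add (p q : XLamPoly d) :
    polyFunction (p + q) = polyFunction p + polyFunction q := by
  ext w; simp [polyFunction, XLamPoly.at]

theorem polyFunction_mul (p q : XLamPoly d) :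
    polyFunction (p * q) = polyFunction p * polyFunction q := by
  ext w; simp [polyFunction, XLamPoly.at]

theorem polyFunction_mem (p : XLamPoly d) : polyFunction p ∈ polyFunctions d := by
  induction p using MvPolynomial.induction_on with
  | C a =>
    convert (polyFunctions d).algebraMap_mem (a : ℂ)
    ext w
    simp [polyFunction, XLamPoly.at, Pi.algebraMap_apply]
  | add p q hp hq =>
    rw [polyFunction_add]
    exact add_mem hp hq
  | mul_X p a hp =>
    rw [polyFunction_mul]
    exact mul_mem hp (Algebra.subset_adjoin ⟨a, rfl⟩)

theorem exists_polyFunction_add_I_smul {f : CircleSimplex d → ℂ} (hf : f ∈ polyFunctions d) :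
    ∃ p r : XLamPoly d, f = polyFunction p + Complex.I • polyFunction r := by
  induction hf using Algebra.adjoin_induction with
  | mem f hf =>
    obtain ⟨a, rfl⟩ := hf
    exact ⟨X a, 0, by ext w; simp [polyFunction, XLamPoly.at]⟩
  | algebraMap c =>
    refine ⟨C c.re, C c.im, ?_⟩
    ext w
    simp only [polyFunction, XLamPoly.at, Pi.algebraMap_apply, Pi.add_apply, Pi.smul_apply,
      eval_C, smul_eq_mul, mul_comm Complex.I]
    exact (Complex.re_add_im c).symm
  | add f g _ _ hf hg =>
    obtain ⟨p, r, rfl⟩ := hf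
    obtain ⟨p', r', rfl⟩ := hg
    refine ⟨p + p', r + r', ?_⟩
    simp only [polyFunction_add, smul_add]
    abel
  | mul f g _ _ hf hg =>
    obtain ⟨p, r, rfl⟩ := hf
    obtain ⟨p', r', rfl⟩ := hg
    refine ⟨p * p' + (-1 : XLamPoly d) * (r * r'), p * r' + r * p', ?_⟩
    simp only [polyFunction_add, polyFunction_mul]
    ext w
    have : polyFunction (-1 : XLamPoly d) w = -1 := by simp [polyFunction, XLamPoly.at]
    simp only [Pi.add_apply, Pi.mul_apply, Pi.smul_apply, smul_eq_mul, this]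
    linear_combination (polyFunction r w * polyFunction r' w) * Complex.I_mul_I

theorem star_mem_polyFunctions {f : CircleSimplex d → ℂ} (hf : f ∈ polyFunctions d) :
    star f ∈ polyFunctions d := by
  obtain ⟨p, r, rfl⟩ := exists_polyFunction_add_I_smul hf
  have h : ∀ p : XLamPoly d, star (polyFunction p) = polyFunction p := fun p => by
    ext w; simp [polyFunction]
  rw [star_add, star_smul, h, h]
  exact add_mem (polyFunction_mem p) ((polyFunctions d).smul_mem (polyFunction_mem r) _)

theorem z_mem_polyFunctions : CircleSimplex.z ∈ polyFunctions d := by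
  have : (CircleSimplex.z : CircleSimplex d → ℂ) =
      polyFunction (X (Sum.inl 0)) + Complex.I • polyFunction (X (Sum.inl 1)) := by
    ext w; simp [polyFunction, XLamPoly.at, CircleSimplex.z]
  rw [this]
  exact add_mem (polyFunction_mem _) ((polyFunctions d).smul_mem (polyFunction_mem _) _)

theorem CircleSimplex.star_z_mul_z (w : CircleSimplex d) : star w.z * w.z = 1 := by
  have h : star w.z = (w.1.1.1 : ℂ) - Complex.I * (w.1.1.2 : ℂ) := by
    change (starRingEnd ℂ) w.z = _
    simp [CircleSimplex.z, sub_eq_add_neg]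
  have h1 : ((w.1.1.1 : ℂ)) ^ 2 + (w.1.1.2 : ℂ) ^ 2 = 1 := by exact_mod_cast w.2.1
  rw [h, CircleSimplex.z]
  linear_combination h1 - (w.1.1.2 : ℂ) ^ 2 * Complex.I_mul_I

theorem zpow_z_mem_polyFunctions (k : ℤ) : (fun w => w.z ^ k) ∈ polyFunctions d := by
  cases k with
  | ofNat k =>
    convert pow_mem (z_mem_polyFunctions (d := d)) k using 1
    ext w
    simp
  | negSucc k =>
    convert pow_mem (star_mem_polyFunctions (z_mem_polyFunctions (d := d))) (k + 1) using 1
    ext w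
    rw [zpow_negSucc, ← inv_pow, ← eq_inv_of_mul_eq_one_left w.star_z_mul_z]
    rfl

theorem fir_mem_polyFunctions (k k' : ℕ) (c : Fin (k + k' + 1) → ℝ) :
    (fun w => fir k k' c w.z) ∈ polyFunctions d := by
  have : (fun w : CircleSimplex d => fir k k' c w.z) =
      ∑ i : Fin (k + k' + 1), (c i : ℂ) • fun w : CircleSimplex d =>
        w.z ^ ((k : ℤ) - ((i : ℕ) : ℤ)) := by
    ext w; simp [fir]
  rw [this]
  exact sum_mem fun i _ => (polyFunctions d).smul_mem (zpow_z_mem_polyFunctions _) _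

/-- The product of the denominators of all coefficients of the plant. -/
noncomputable def UncertainPlant.commonDen (P : UncertainPlant d) : MvPolynomial (Fin d) ℝ :=
  (∏ i, (P.b i).den) * ∏ i, (P.a i).den

theorem UncertainPlant.WellDefined.commonDen_ne_zero {P : UncertainPlant d} (hP : P.WellDefined)
    {lam : Fin d → ℝ} (h : lam ∈ stdSimplex ℝ (Fin d)) : eval lam P.commonDen ≠ 0 := by
  rw [UncertainPlant.commonDen, map_mul, map_prod, map_prod]
  exact mul_ne_zero (Finset.prod_ne_zero_iff.2 fun i _ => hP.b_regular i lam h)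
    (Finset.prod_ne_zero_iff.2 fun i _ => hP.a_regular i lam h)

theorem eval_mem_polyFunctions (p : MvPolynomial (Fin d) ℝ) :
    (fun w : CircleSimplex d => (eval w.1.2 p : ℂ)) ∈ polyFunctions d := by
  convert polyFunction_mem (rename Sum.inr p : XLamPoly d) using 1
  ext w
  rw [polyFunction, XLamPoly.at, eval_rename]
  rfl

theorem eval_mul_val_mem_polyFunctions (p : MvPolynomial (Fin d) ℝ) (r : RatFn d)
    (hp : r.den ∣ p) (hr : ∀ lam ∈ stdSimplex ℝ (Fin d), eval lam r.den ≠ 0) :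
    (fun w : CircleSimplex d => (eval w.1.2 p : ℂ) * (r.val w.1.2 : ℂ)) ∈ polyFunctions d := by
  obtain ⟨c, rfl⟩ := hp
  convert eval_mem_polyFunctions (r.num * c) using 1
  ext w
  rw [← Complex.ofReal_mul, RatFn.val, map_mul, map_mul]
  congr 1
  have := hr _ w.2.2
  field_simp

theorem numAt_mem_polyFunctions {P : UncertainPlant d} (hP : P.WellDefined) :
    (fun w : CircleSimplex d => (eval w.1.2 P.commonDen : ℂ) * P.numAt w.z w.1.2) ∈
      polyFunctions d := by
  have : (fun w : CircleSimplex d => (eval w.1.2 P.commonDen : ℂ) * P.numAt w.z w.1.2) =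
      ∑ i : Fin (P.m + 1), (fun w : CircleSimplex d =>
        (eval w.1.2 P.commonDen : ℂ) * ((P.b i).val w.1.2 : ℂ)) * CircleSimplex.z ^ (i : ℕ) := by
    ext w
    simp [UncertainPlant.numAt, Finset.mul_sum, mul_assoc]
  rw [this]
  refine sum_mem fun i _ => mul_mem (eval_mul_val_mem_polyFunctions _ _ ?_ (hP.b_regular i))
    (pow_mem z_mem_polyFunctions _)
  exact (Finset.dvd_prod_of_mem (fun i => (P.b i).den) (Finset.mem_univ i)).mul_right _

theorem denAt_mem_polyFunctions {P : UncertainPlant d} (hP : P.WellDefined) :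
    (fun w : CircleSimplex d => (eval w.1.2 P.commonDen : ℂ) * P.denAt w.z w.1.2) ∈
      polyFunctions d := by
  have : (fun w : CircleSimplex d => (eval w.1.2 P.commonDen : ℂ) * P.denAt w.z w.1.2) =
      (fun w : CircleSimplex d => (eval w.1.2 P.commonDen : ℂ)) * CircleSimplex.z ^ P.n +
      ∑ i : Fin P.n, (fun w : CircleSimplex d =>
        (eval w.1.2 P.commonDen : ℂ) * ((P.a i).val w.1.2 : ℂ)) * CircleSimplex.z ^ (i : ℕ) := by
    ext w
    simp [UncertainPlant.denAt, Finset.mul_sum, mul_assoc, mul_add]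
  rw [this]
  refine add_mem (mul_mem (eval_mem_polyFunctions _) (pow_mem z_mem_polyFunctions _))
    (sum_mem fun i _ => mul_mem (eval_mul_val_mem_polyFunctions _ _ ?_ (hP.a_regular i))
      (pow_mem z_mem_polyFunctions _))
  exact (Finset.dvd_prod_of_mem (fun i => (P.a i).den) (Finset.mem_univ i)).mul_left _

/-- The affine map `l ↦ p₀ + ∑ lᵢ pᵢ`. -/
noncomputable def affineCombination {n : ℕ} (p₀ : XLamPoly d) (p : Fin n → XLamPoly d) :
    (Fin n → ℝ) →ᵃ[ℝ] XLamPoly d :=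
  (Fintype.linearCombination ℝ p).toAffineMap + AffineMap.const ℝ (Fin n → ℝ) p₀

theorem affineCombination_at {n : ℕ} (p₀ : XLamPoly d) (p : Fin n → XLamPoly d) (l : Fin n → ℝ)
    (x₁ x₂ : ℝ) (lam : Fin d → ℝ) :
    (affineCombination p₀ p l).at x₁ x₂ lam =
      ∑ i, l i * (p i).at x₁ x₂ lam + p₀.at x₁ x₂ lam := by
  simp [affineCombination, XLamPoly.at, Fintype.linearCombination_apply, smul_eval]

/-- Fraction form of the error transfer function. With the coefficients of the plant brought to
a common denominator, `N` and `D` the resulting numerator and denominator, the fraction is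
`Q (D - z L N) conj(D) / |D|²`. -/
theorem exists_isFractionForm (P : UncertainPlant d) (hP : P.WellDefined)
    (k₁ k₂ k₃ k₄ : ℕ) (q : Fin (k₃ + k₄ + 1) → ℝ) :
    ∃ (ν₁ ν₂ : (Fin (k₁ + k₂ + 1) → ℝ) →ᵃ[ℝ] XLamPoly d) (ν₃ : XLamPoly d),
      IsFractionForm P q ν₁ ν₂ ν₃ := by
  set N : CircleSimplex d → ℂ := fun w => (eval w.1.2 P.commonDen : ℂ) * P.numAt w.z w.1.2 with hN
  set D : CircleSimplex d → ℂ := fun w => (eval w.1.2 P.commonDen : ℂ) * P.denAt w.z w.1.2 with hD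
  set Q : CircleSimplex d → ℂ := fun w => fir k₃ k₄ q w.z with hQ
  have hNm : N ∈ polyFunctions d := numAt_mem_polyFunctions hP
  have hDm : D ∈ polyFunctions d := denAt_mem_polyFunctions hP
  have hDs := star_mem_polyFunctions hDm
  have hQm : Q ∈ polyFunctions d := fir_mem_polyFunctions _ _ _
  obtain ⟨p₃, r₃, h₃⟩ := exists_polyFunction_add_I_smul (mul_mem hDm hDs)
  obtain ⟨p₀, r₀, h₀⟩ := exists_polyFunction_add_I_smul (mul_mem (mul_mem hQm hDm) hDs)
  choose p r hpr using fun i : Fin (k₁ + k₂ + 1) => exists_polyFunction_add_I_smul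
    (neg_mem (mul_mem (mul_mem (mul_mem (mul_mem (z_mem_polyFunctions (d := d)) hQm)
      (zpow_z_mem_polyFunctions ((k₁ : ℤ) - ((i : ℕ) : ℤ)))) hNm) hDs))
  have hnorm : ∀ w : CircleSimplex d, ‖w.z‖ = 1 := fun w => by
    have h1 := congrArg norm w.star_z_mul_z
    rw [norm_mul, norm_star, norm_one] at h1
    nlinarith [norm_nonneg w.z]
  have hcd : ∀ w : CircleSimplex d, (eval w.1.2 P.commonDen : ℂ) ≠ 0 := fun w => by
    exact_mod_cast hP.commonDen_ne_zero w.2.2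
  have hden : ∀ w : CircleSimplex d, P.denAt w.z w.1.2 ≠ 0 := fun w =>
    hP.den_ne_zero _ w.2.2 _ (hnorm w)
  have hD0 : ∀ w, D w ≠ 0 := fun w => mul_ne_zero (hcd w) (hden w)
  -- `ν₃` is the real part of the polynomial for `D conj(D)`, whose imaginary part vanishes as a
  -- function.
  have h₃' : ∀ w, D w * star (D w) = polyFunction p₃ w := fun w => by
    have h1 := congrFun h₃ w
    have h2 : (D w * star (D w)).im = 0 := by
      change (D w * (starRingEnd ℂ) (D w)).im = 0
      rw [Complex.mul_conj]
      exact Complex.ofReal_im _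
    have h3 : D w * star (D w) = (D * star D) w := rfl
    rw [h3, h1] at h2 ⊢
    simp only [Pi.add_apply, Pi.smul_apply, polyFunction, smul_eq_mul] at h2 ⊢
    simp at h2
    simp [h2]
  refine ⟨affineCombination p₀ p, affineCombination r₀ r, p₃, ?_, ?_⟩
  · intro x₁ x₂ hx lam hlam h0
    have h1 := h₃' ⟨((x₁, x₂), lam), hx, hlam⟩
    rw [polyFunction, h0, Complex.ofReal_zero] at h1
    exact mul_ne_zero (hD0 _) (star_ne_zero.2 (hD0 _)) h1
  · intro l x₁ x₂ hx lam hlam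
    set w : CircleSimplex d := ⟨((x₁, x₂), lam), hx, hlam⟩ with hw
    have hz : (x₁ : ℂ) + Complex.I * (x₂ : ℂ) = w.z := rfl
    have hnum : ((affineCombination p₀ p l).at x₁ x₂ lam : ℂ) +
        Complex.I * ((affineCombination r₀ r l).at x₁ x₂ lam : ℂ) =
        Q w * (D w - w.z * fir k₁ k₂ l w.z * N w) * star (D w) := by
      have h1 : Q w * D w * star (D w) =
          (p₀.at x₁ x₂ lam : ℂ) + Complex.I * (r₀.at x₁ x₂ lam : ℂ) := congrFun h₀ w
      have h2 : ∀ i : Fin (k₁ + k₂ + 1),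
          -(w.z * Q w * w.z ^ ((k₁ : ℤ) - ((i : ℕ) : ℤ)) * N w * star (D w)) =
          ((p i).at x₁ x₂ lam : ℂ) + Complex.I * ((r i).at x₁ x₂ lam : ℂ) := fun i =>
        congrFun (hpr i) w
      rw [affineCombination_at, affineCombination_at]
      push_cast
      have h3 : ∑ i, (l i : ℂ) * ((p i).at x₁ x₂ lam : ℂ) +
          Complex.I * ∑ i, (l i : ℂ) * ((r i).at x₁ x₂ lam : ℂ) =
          -(w.z * Q w * fir k₁ k₂ l w.z * N w * star (D w)) := by
        rw [fir, Finset.mul_sum, ← Finset.sum_add_distrib]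
        simp only [Finset.mul_sum, Finset.sum_mul, ← Finset.sum_neg_distrib]
        refine Finset.sum_congr rfl fun i _ => ?_
        linear_combination -(l i : ℂ) * h2 i
      linear_combination h3 - h1
    have h3 : ((p₃.at x₁ x₂ lam : ℝ) : ℂ) = D w * star (D w) := (h₃' w).symm
    rw [hnum, h3, hz, errorTF, UncertainPlant.tf, mul_div_mul_right _ _ (star_ne_zero.2 (hD0 w)),
      eq_div_iff (hD0 w)]
    change Q w * (1 - w.z * fir k₁ k₂ l w.z * (P.numAt w.z w.1.2 / P.denAt w.z w.1.2)) * D w = _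
    have h4 : P.numAt w.z w.1.2 / P.denAt w.z w.1.2 * D w = N w := by
      simp only [hN, hD]
      have := hden w
      field_simp
    linear_combination (-Q w * w.z * fir k₁ k₂ l w.z) * h4

end FractionForm

/-! ### Sums of squares and positivity on the circle times the simplex -/

section SOSCertificate

open Finset

variable {d : ℕ}

theorem isSOS_of_rank_one {σ ι : Type*} [Fintype ι] (g : ι → Fin 3 → MvPolynomial σ ℝ) :
    IsSOS (Matrix.of fun i j => ∑ k, g k i * g k j) := by
  -- each rank one term is `Fᵀ F` for the matrix `F` whose first row is `g k` and whose other rows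
  -- vanish
  refine ⟨Fintype.card ι, fun r => Matrix.of fun a b =>
    if a = 0 then g ((Fintype.equivFin ι).symm r) b else 0, ?_⟩
  ext1 i j
  rw [Matrix.sum_apply, Matrix.of_apply, ← (Fintype.equivFin ι).symm.sum_comp]
  refine sum_congr rfl fun k _ => ?_
  simp [Matrix.mul_apply]

theorem IsSOS.posSemidef_eval {σ : Type*} {M : Matrix (Fin 3) (Fin 3) (MvPolynomial σ ℝ)}
    (hM : IsSOS M) (u : σ → ℝ) (v : Fin 3 → ℝ) :
    0 ≤ ∑ i, ∑ j, v i * eval u (M i j) * v j := by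
  obtain ⟨r, F, rfl⟩ := hM
  have h : ∑ i, ∑ j, v i * eval u ((∑ k, (F k).transpose * F k) i j) * v j =
      ∑ k, ∑ a, (∑ i, eval u (F k a i) * v i) ^ 2 := by
    simp only [Matrix.sum_apply, Matrix.mul_apply, Matrix.transpose_apply, map_sum, map_mul,
      sum_mul, mul_sum, sq]
    have h1 : ∀ i : Fin 3, ∑ j : Fin 3, ∑ k : Fin r, ∑ a : Fin 3,
        v i * (eval u (F k a i) * eval u (F k a j)) * v j =
        ∑ k : Fin r, ∑ a : Fin 3, ∑ j : Fin 3,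
          v i * (eval u (F k a i) * eval u (F k a j)) * v j := fun i => by
      rw [sum_comm]
      exact sum_congr rfl fun k _ => sum_comm
    simp only [h1]
    rw [sum_comm]
    refine sum_congr rfl fun k _ => ?_
    rw [sum_comm]
    refine sum_congr rfl fun a _ => ?_
    rw [sum_comm]
    exact sum_congr rfl fun i _ => sum_congr rfl fun j _ => by ring
  rw [h]
  exact sum_nonneg fun k _ => sum_nonneg fun a _ => sq_nonneg _

theorem l2norm_pow (lam : Fin d → ℝ) (k : ℕ) : l2norm lam ^ (2 * k) = (∑ i, sqVec lam i) ^ k := by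
  rw [pow_mul, l2norm, EuclideanSpace.real_norm_sq_eq]
  rfl

theorem expDegX_le_degX (M : Matrix (Fin 3) (Fin 3) (XLamPoly d)) (i j : Fin 3)
    {s : (Fin 2 ⊕ Fin d) →₀ ℕ} (hs : s ∈ (M i j).support) : expDegX s ≤ degX M :=
  (le_sup (f := expDegX) hs).trans
    ((le_sup (f := fun j => (M i j).support.sup expDegX) (mem_univ j)).trans
      (le_sup (f := fun i => univ.sup fun j => (M i j).support.sup expDegX) (mem_univ i)))

theorem expDegLam_le_degLam (M : Matrix (Fin 3) (Fin 3) (XLamPoly d)) (i j : Fin 3)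
    {s : (Fin 2 ⊕ Fin d) →₀ ℕ} (hs : s ∈ (M i j).support) : expDegLam s ≤ degLam M :=
  (le_sup (f := expDegLam) hs).trans
    ((le_sup (f := fun j => (M i j).support.sup expDegLam) (mem_univ j)).trans
      (le_sup (f := fun i => univ.sup fun j => (M i j).support.sup expDegLam) (mem_univ i)))

/-- The function `(1 + x²) ^ N polyValue p ((1 - x²) / (1 + x²)) (2 x / (1 + x²)) y t` as a
polynomial in `x`, for `N` at least the degree of `p` in `(x₁, x₂)`. -/
noncomputable def polyaPolynomial (N : ℕ) (p : XLamPoly d) (y : Fin d → ℝ) (t : ℝ) :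
    Polynomial ℝ :=
  ∑ s ∈ p.support, Polynomial.C (coeff s p * polyaWeight (fun i => s (Sum.inr i)) y t) *
    ((1 - Polynomial.X ^ 2) ^ s (Sum.inl 0) * (2 * Polynomial.X) ^ s (Sum.inl 1) *
      (1 + Polynomial.X ^ 2) ^ (N - expDegX s))

theorem eval_polyaPolynomial (N : ℕ) (p : XLamPoly d) (hp : ∀ s ∈ p.support, expDegX s ≤ N)
    (y : Fin d → ℝ) (t x : ℝ) :
    (polyaPolynomial N p y t).eval x =
      (1 + x ^ 2) ^ N * polyaValue p ((1 - x ^ 2) / (1 + x ^ 2)) (2 * x / (1 + x ^ 2)) y t := by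
  rw [polyaPolynomial, polyaValue, Polynomial.eval_finsetSum, mul_sum]
  refine sum_congr rfl fun s hs => ?_
  have hx : (1 + x ^ 2 : ℝ) ≠ 0 := by positivity
  have h1 : (1 + x ^ 2) ^ N = (1 + x ^ 2) ^ s (Sum.inl 0) * (1 + x ^ 2) ^ s (Sum.inl 1) *
      (1 + x ^ 2) ^ (N - expDegX s) := by
    rw [← pow_add, ← pow_add]
    congr 1
    have := hp s hs
    rw [expDegX, Fin.sum_univ_two] at this ⊢
    omega
  have h2 : ∀ a : ℕ, (1 + x ^ 2 : ℝ) ^ a ≠ 0 := fun a => pow_ne_zero _ hx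
  simp only [Polynomial.eval_mul, Polynomial.eval_pow, Polynomial.eval_sub, Polynomial.eval_add,
    Polynomial.eval_C, Polynomial.eval_X, Polynomial.eval_one, Polynomial.eval_ofNat, h1, div_pow]
  have h3 := h2 (s (Sum.inl 0))
  have h4 := h2 (s (Sum.inl 1))
  field_simp

theorem rational_param_mem_circle (x : ℝ) :
    ((1 - x ^ 2) / (1 + x ^ 2)) ^ 2 + (2 * x / (1 + x ^ 2)) ^ 2 = 1 := by
  have hx : (1 + x ^ 2 : ℝ) ≠ 0 := by positivity
  field_simp
  ring

/-- A symmetric matrix polynomial that is positive definite on the circle times the simplex has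
a sum of squares certificate: the coefficients of its product with a power of `∑ lam` are positive
definite in `x`, so they are sums of squares, and replacing `lam` by its vector of squares turns
the monomials in `lam` into squares. -/
theorem exists_isSOSMatrixPolynomial (M : Matrix (Fin 3) (Fin 3) (XLamPoly d))
    (hM : ∀ i j, M i j = M j i)
    (hpos : ∀ x₁ x₂ : ℝ, x₁ ^ 2 + x₂ ^ 2 = 1 → ∀ y ∈ stdSimplex ℝ (Fin d),
      ∀ v : Fin 3 → ℝ, v ≠ 0 → 0 < ∑ i, ∑ j, v i * (M i j).at x₁ x₂ y * v j) :
    ∃ ε : ℝ, 0 < ε ∧ ∃ k : ℕ, IsSOSMatrixPolynomial fun (x : ℝ) (lam : Fin d → ℝ) =>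
      ((1 + x ^ 2) ^ degX M * l2norm lam ^ (2 * k)) •
        (hatMat M x (sqVec lam) - (ε * l2norm lam ^ (2 * degLam M)) •
          (1 : Matrix (Fin 3) (Fin 3) ℝ)) := by
  obtain ⟨ε, hε, n₀, hn₀⟩ := exists_lower_bound_polyaValue M hpos
  refine ⟨ε, hε, n₀ + 1, ?_⟩
  set D := degLam M with hD
  set N := degX M with hN
  set n := n₀ + 1 + D with hn
  have hn1 : 0 < n := by omega
  have hnR : (n : ℝ) ≠ 0 := by positivity
  set y : (Fin d → ℕ) → Fin d → ℝ := fun β i => (β i : ℝ) / n with hy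
  -- the matrix polynomial in `x` that goes with the monomial of exponent `β`
  set A : (Fin d → ℕ) → Matrix (Fin 3) (Fin 3) (Polynomial ℝ) := fun β => Matrix.of fun i j =>
    polyaPolynomial N (M i j) (y β) (1 / n) -
      if i = j then Polynomial.C ε * (1 + Polynomial.X ^ 2) ^ N else 0 with hA
  have hAe : ∀ β i j x, (A β i j).eval x = (1 + x ^ 2) ^ N *
      (polyaValue (M i j) ((1 - x ^ 2) / (1 + x ^ 2)) (2 * x / (1 + x ^ 2)) (y β) (1 / n) -
        if i = j then ε else 0) := by
    intro β i j x
    simp only [hA, Matrix.of_apply, Polynomial.eval_sub]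
    rw [eval_polyaPolynomial N _ fun s hs => expDegX_le_degX M i j hs, mul_sub]
    congr 1
    split_ifs
    · simp [mul_comm]
    · simp
  have hsq : ∀ β : (piAntidiag univ n : Finset (Fin d → ℕ)),
      ∃ (m : ℕ) (f : Fin m ⊕ Fin m → Fin 3 → Polynomial ℝ),
        ∀ i j, A β i j = ∑ k, f k i * f k j := by
    rintro ⟨β, hβ⟩
    refine Polynomial.exists_sum_of_squares_of_posDef (A β)
      (fun i j => by simp only [hA, Matrix.of_apply, hM i j, eq_comm]) fun x v hv => ?_
    have hyβ : y β ∈ stdSimplex ℝ (Fin d) := by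
      refine ⟨fun i => by positivity, ?_⟩
      have h1 : ∑ i, β i = n := (mem_piAntidiag.1 hβ).1
      simp only [hy]
      rw [← sum_div, ← Nat.cast_sum, h1, div_self hnR]
    have h1 := hn₀ n (by omega) _ _ (rational_param_mem_circle x) _ hyβ v hv
    have h2 : ∑ i, ∑ j, v i * (A β i j).eval x * v j = (1 + x ^ 2) ^ N *
        ((∑ i, ∑ j, v i * polyaValue (M i j) ((1 - x ^ 2) / (1 + x ^ 2)) (2 * x / (1 + x ^ 2))
          (y β) (1 / n) * v j) - ε * ∑ i, v i ^ 2) := by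
      simp only [hAe, Fin.sum_univ_three]
      simp
      ring
    rw [h2]
    exact mul_pos (by positivity) (sub_pos.2 h1)
  choose m f hf using hsq
  set g : (Σ β : (piAntidiag univ n : Finset (Fin d → ℕ)), Fin (m β) ⊕ Fin (m β)) → Fin 3 →
      MvPolynomial (Unit ⊕ Fin d) ℝ := fun k i =>
    C (Real.sqrt (Nat.multinomial univ k.1.1)) * (∏ a, X (Sum.inr a) ^ k.1.1 a) *
      Polynomial.aeval (X (Sum.inl ())) (f k.1 k.2 i) with hg
  refine ⟨_, fun x lam => ?_, isSOS_of_rank_one g⟩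
  set u : Unit ⊕ Fin d → ℝ := Sum.elim (fun _ => x) lam with hu
  have hge : ∀ k i, eval u (g k i) = Real.sqrt (Nat.multinomial univ k.1.1) *
      (∏ a, lam a ^ k.1.1 a) * (f k.1 k.2 i).eval x := by
    intro k i
    have h1 : eval u (Polynomial.aeval (X (Sum.inl ()) : MvPolynomial (Unit ⊕ Fin d) ℝ)
        (f k.1 k.2 i)) = (f k.1 k.2 i).eval x := by
      rw [← MvPolynomial.coe_aeval_eq_eval, RingHom.coe_coe, ← Polynomial.aeval_algHom_apply]
      simp [hu]
    simp only [hg, map_mul, map_prod, map_pow, eval_C, eval_X, h1]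
    simp [hu]
  ext1 i j
  have hδ : ((1 : Matrix (Fin 3) (Fin 3) ℝ) i j) * ε = if i = j then ε else 0 := by
    rw [Matrix.one_apply]
    split_ifs <;> simp
  have hlhs : (((1 + x ^ 2) ^ N * l2norm lam ^ (2 * (n₀ + 1))) •
      (hatMat M x (sqVec lam) - (ε * l2norm lam ^ (2 * D)) •
        (1 : Matrix (Fin 3) (Fin 3) ℝ))) i j =
      ∑ β ∈ piAntidiag univ n, (Nat.multinomial univ β : ℝ) * (A β i j).eval x *
        ∏ a, sqVec lam a ^ β a := by
    rw [Matrix.smul_apply, Matrix.sub_apply, Matrix.smul_apply, l2norm_pow, l2norm_pow]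
    have h1 := homPoly_at_mul_sum_pow D (n₀ + 1) hn1 (M i j)
      (fun s hs => expDegLam_le_degLam M i j hs) ((1 - x ^ 2) / (1 + x ^ 2))
      (2 * x / (1 + x ^ 2)) (sqVec lam)
    have h2 : (∑ a, sqVec lam a) ^ n = ∑ β ∈ piAntidiag univ n,
        (Nat.multinomial univ β : ℝ) * ∏ a, sqVec lam a ^ β a := sum_pow_eq_sum_piAntidiag _ _ _
    have h3 : (∑ a, sqVec lam a) ^ n =
        (∑ a, sqVec lam a) ^ (n₀ + 1) * (∑ a, sqVec lam a) ^ D := pow_add _ _ _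
    have h4 : hatMat M x (sqVec lam) i j =
      (homPoly D (M i j)).at ((1 - x ^ 2) / (1 + x ^ 2)) (2 * x / (1 + x ^ 2)) (sqVec lam) := rfl
    rw [h4]
    have h5 : ∑ β ∈ piAntidiag univ n, (Nat.multinomial univ β : ℝ) * (A β i j).eval x *
        ∏ a, sqVec lam a ^ β a = (1 + x ^ 2) ^ N *
        ((∑ β ∈ piAntidiag univ n, (Nat.multinomial univ β : ℝ) *
          polyaValue (M i j) ((1 - x ^ 2) / (1 + x ^ 2)) (2 * x / (1 + x ^ 2)) (y β) (1 / n) *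
            ∏ a, sqVec lam a ^ β a) - (if i = j then ε else 0) *
        ∑ β ∈ piAntidiag univ n, (Nat.multinomial univ β : ℝ) * ∏ a, sqVec lam a ^ β a) := by
      rw [mul_sum _ _ (if i = j then ε else 0), ← sum_sub_distrib, mul_sum]
      refine sum_congr rfl fun β _ => ?_
      rw [hAe]
      ring
    rw [h5, ← h1, ← h2, ← hδ, h3]
    simp only [smul_eq_mul]
    ring
  refine hlhs.trans ?_
  rw [Matrix.map_apply, Matrix.of_apply, map_sum, Fintype.sum_sigma,
    ← sum_coe_sort (piAntidiag univ n)]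
  refine sum_congr rfl fun β _ => ?_
  rw [hf β i j, Polynomial.eval_finsetSum, mul_sum, sum_mul]
  refine sum_congr rfl fun k _ => ?_
  rw [map_mul, hge, hge, Polynomial.eval_mul]
  have h1 : ∏ a, sqVec lam a ^ β.1 a = (∏ a, lam a ^ β.1 a) * ∏ a, lam a ^ β.1 a := by
    rw [← prod_mul_distrib]
    refine prod_congr rfl fun a _ => ?_
    rw [sqVec]
    ring
  have h2 := Real.mul_self_sqrt (Nat.cast_nonneg (α := ℝ) (Nat.multinomial univ β.1))
  rw [h1]
  linear_combination (-(∏ a, lam a ^ β.1 a) * (∏ a, lam a ^ β.1 a) *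
    (f β k i).eval x * (f β k j).eval x) * h2

theorem homPoly_at_of_mem_stdSimplex (D : ℕ) (p : XLamPoly d) (x₁ x₂ : ℝ) {lam : Fin d → ℝ}
    (h : lam ∈ stdSimplex ℝ (Fin d)) : (homPoly D p).at x₁ x₂ lam = p.at x₁ x₂ lam := by
  rw [homPoly_at, at_eq_sum, h.2]
  simp

theorem continuous_at_comp (p : XLamPoly d) (lam : Fin d → ℝ) {f g : ℝ → ℝ} (hf : Continuous f)
    (hg : Continuous g) : Continuous fun θ => p.at (f θ) (g θ) lam := by
  simp only [at_eq_sum]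
  fun_prop

/-- Conversely, a sum of squares certificate bounds the matrix polynomial from below. The rational
parametrization misses the point `(-1, 0)` of the circle, which is reached by continuity. -/
theorem lower_bound_of_isSOSMatrixPolynomial (M : Matrix (Fin 3) (Fin 3) (XLamPoly d)) {ε : ℝ}
    {k : ℕ} (h : IsSOSMatrixPolynomial fun (x : ℝ) (lam : Fin d → ℝ) =>
      ((1 + x ^ 2) ^ degX M * l2norm lam ^ (2 * k)) •
        (hatMat M x (sqVec lam) - (ε * l2norm lam ^ (2 * degLam M)) •
          (1 : Matrix (Fin 3) (Fin 3) ℝ)))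
    {x₁ x₂ : ℝ} (hx : x₁ ^ 2 + x₂ ^ 2 = 1) {lam : Fin d → ℝ} (hlam : lam ∈ stdSimplex ℝ (Fin d))
    (v : Fin 3 → ℝ) : ε * ∑ i, v i ^ 2 ≤ ∑ i, ∑ j, v i * (M i j).at x₁ x₂ lam * v j := by
  obtain ⟨S, hS, hsos⟩ := h
  have hparam : ∀ x : ℝ, ε * ∑ i, v i ^ 2 ≤ ∑ i, ∑ j, v i *
      (M i j).at ((1 - x ^ 2) / (1 + x ^ 2)) (2 * x / (1 + x ^ 2)) lam * v j := by
    intro x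
    set r : Fin d → ℝ := fun i => Real.sqrt (lam i) with hr
    have hsq : sqVec r = lam := funext fun i => Real.sq_sqrt (hlam.1 i)
    have h1 := hsos.posSemidef_eval (Sum.elim (fun _ => x) r) v
    have h2 : ∀ i j, eval (Sum.elim (fun _ => x) r) (S i j) = (1 + x ^ 2) ^ degX M *
        ((M i j).at ((1 - x ^ 2) / (1 + x ^ 2)) (2 * x / (1 + x ^ 2)) lam -
          ε * (1 : Matrix (Fin 3) (Fin 3) ℝ) i j) := by
      intro i j
      have h3 : (((1 + x ^ 2) ^ degX M * l2norm r ^ (2 * k)) •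
          (hatMat M x (sqVec r) - (ε * l2norm r ^ (2 * degLam M)) •
            (1 : Matrix (Fin 3) (Fin 3) ℝ))) i j = eval (Sum.elim (fun _ => x) r) (S i j) :=
        congrFun (congrFun (hS x r) i) j
      rw [← h3, Matrix.smul_apply, Matrix.sub_apply, Matrix.smul_apply, l2norm_pow, l2norm_pow,
        hsq, hlam.2, hatMat, homMat, Matrix.map_apply, Matrix.map_apply,
        homPoly_at_of_mem_stdSimplex _ _ _ _ hlam]
      simp
    have h4 : ∑ i, ∑ j, v i * eval (Sum.elim (fun _ => x) r) (S i j) * v j =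
        (1 + x ^ 2) ^ degX M * ((∑ i, ∑ j, v i *
          (M i j).at ((1 - x ^ 2) / (1 + x ^ 2)) (2 * x / (1 + x ^ 2)) lam * v j) -
            ε * ∑ i, v i ^ 2) := by
      simp only [h2, Fin.sum_univ_three]
      simp
      ring
    rw [h4] at h1
    exact sub_nonneg.1 (nonneg_of_mul_nonneg_right h1 (by positivity))
  have hoff : ∀ a b : ℝ, a ^ 2 + b ^ 2 = 1 → a ≠ -1 →
      ε * ∑ i, v i ^ 2 ≤ ∑ i, ∑ j, v i * (M i j).at a b lam * v j := by
    intro a b hab ha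
    have ha' : 1 + a ≠ 0 := fun h => ha (by linarith)
    have h1 := hparam (b / (1 + a))
    have h2 : 1 + (b / (1 + a)) ^ 2 = 2 / (1 + a) := by
      field_simp
      nlinarith
    have h3 : (1 - (b / (1 + a)) ^ 2) / (1 + (b / (1 + a)) ^ 2) = a := by
      rw [h2]
      field_simp
      nlinarith
    have h4 : 2 * (b / (1 + a)) / (1 + (b / (1 + a)) ^ 2) = b := by
      rw [h2]
      field_simp
    rwa [h3, h4] at h1
  by_cases h1 : x₁ = -1
  · have hx2 : x₂ = 0 := by
      rw [h1] at hx
      nlinarith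
    -- approach `(-1, 0)` along the circle
    have hcont : Continuous fun θ : ℝ => ∑ i, ∑ j, v i *
        (M i j).at (Real.cos θ) (Real.sin θ) lam * v j := by
      refine continuous_finsetSum _ fun i _ => continuous_finsetSum _ fun j _ => ?_
      exact (continuous_const.mul (continuous_at_comp (M i j) lam Real.continuous_cos
        Real.continuous_sin)).mul continuous_const
    have hmem : Real.pi ∈ closure (Set.Ioo 0 Real.pi) := by
      rw [closure_Ioo Real.pi_pos.ne]
      exact ⟨Real.pi_pos.le, le_rfl⟩
    have hle : ∀ θ ∈ Set.Ioo 0 Real.pi, ε * ∑ i, v i ^ 2 ≤ ∑ i, ∑ j, v i *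
        (M i j).at (Real.cos θ) (Real.sin θ) lam * v j := by
      intro θ hθ
      refine hoff _ _ (Real.cos_sq_add_sin_sq θ) fun hc => ?_
      have h3 := Real.sin_pos_of_pos_of_lt_pi hθ.1 hθ.2
      have h4 := Real.cos_sq_add_sin_sq θ
      rw [hc] at h4
      nlinarith
    have h3 := le_on_closure hle continuousOn_const hcont.continuousOn hmem
    rwa [Real.cos_pi, Real.sin_pi, ← h1, ← hx2] at h3
  · exact hoff _ _ hx h1

end SOSCertificate

/-! ### The matrix polynomial of the error transfer function -/

theorem matT_quadratic_form {d : ℕ} (γ : ℝ) (ν₁ ν₂ ν₃ : XLamPoly d) (x₁ x₂ : ℝ)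
    (lam : Fin d → ℝ) (v : Fin 3 → ℝ) :
    ∑ i, ∑ j, v i * (matT γ ν₁ ν₂ ν₃ i j).at x₁ x₂ lam * v j =
      (γ ^ 2 * ν₃.at x₁ x₂ lam ^ 2 - ν₁.at x₁ x₂ lam ^ 2 - ν₂.at x₁ x₂ lam ^ 2) * v 0 ^ 2 +
        (v 1 + ν₁.at x₁ x₂ lam * v 0) ^ 2 + (v 2 + ν₂.at x₁ x₂ lam * v 0) ^ 2 := by
  simp only [Fin.sum_univ_three]
  simp [matT, XLamPoly.at]
  ring

/-- The performance bound at a point, multiplied by `ν₃²`. -/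
theorem IsFractionForm.pos_iff {d : ℕ} {P : UncertainPlant d} {k₁ k₂ k₃ k₄ : ℕ}
    {q : Fin (k₃ + k₄ + 1) → ℝ} {ν₁ ν₂ : (Fin (k₁ + k₂ + 1) → ℝ) →ᵃ[ℝ] XLamPoly d}
    {ν₃ : XLamPoly d} (h : IsFractionForm P q ν₁ ν₂ ν₃) (l : Fin (k₁ + k₂ + 1) → ℝ) (γ : ℝ)
    {x₁ x₂ : ℝ} (hx : x₁ ^ 2 + x₂ ^ 2 = 1) {lam : Fin d → ℝ}
    (hlam : lam ∈ stdSimplex ℝ (Fin d)) :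
    0 < γ ^ 2 - ‖errorTF P q l ((x₁ : ℂ) + Complex.I * (x₂ : ℂ)) lam‖ ^ 2 ↔
      0 < γ ^ 2 * ν₃.at x₁ x₂ lam ^ 2 - (ν₁ l).at x₁ x₂ lam ^ 2 - (ν₂ l).at x₁ x₂ lam ^ 2 := by
  have h3 := h.den_ne_zero x₁ x₂ hx lam hlam
  have hn : ∀ a b : ℝ, ‖(a : ℂ) + Complex.I * (b : ℂ)‖ ^ 2 = a ^ 2 + b ^ 2 := fun a b => by
    rw [← Complex.normSq_eq_norm_sq, mul_comm, Complex.normSq_add_mul_I]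
  rw [h.eq_fraction l x₁ x₂ hx lam hlam, norm_div, div_pow, hn, Complex.norm_real,
    Real.norm_eq_abs, sq_abs, sub_pos, div_lt_iff₀ (by positivity), sub_sub, sub_pos]

theorem exists_circle_coordinates {z : ℂ} (hz : ‖z‖ = 1) :
    ∃ x₁ x₂ : ℝ, x₁ ^ 2 + x₂ ^ 2 = 1 ∧ z = (x₁ : ℂ) + Complex.I * (x₂ : ℂ) := by
  refine ⟨z.re, z.im, ?_, ?_⟩
  · rw [← Complex.normSq_add_mul_I, Complex.re_add_im, Complex.normSq_eq_norm_sq, hz, one_pow]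
  · rw [mul_comm, Complex.re_add_im]

theorem norm_circle_coordinates {x₁ x₂ : ℝ} (h : x₁ ^ 2 + x₂ ^ 2 = 1) :
    ‖(x₁ : ℂ) + Complex.I * (x₂ : ℂ)‖ = 1 := by
  rw [mul_comm, ← sq_eq_sq₀ (norm_nonneg _) zero_le_one, ← Complex.normSq_eq_norm_sq,
    Complex.normSq_add_mul_I, h, one_pow]

theorem lemma3 {d : ℕ} (P : UncertainPlant d) (hP : P.WellDefined)
    (k₁ k₂ k₃ k₄ : ℕ) (q : Fin (k₃ + k₄ + 1) → ℝ) :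
    (∃ (ν₁ ν₂ : (Fin (k₁ + k₂ + 1) → ℝ) →ᵃ[ℝ] XLamPoly d) (ν₃ : XLamPoly d),
      IsFractionForm P q ν₁ ν₂ ν₃) ∧
    ∀ (ν₁ ν₂ : (Fin (k₁ + k₂ + 1) → ℝ) →ᵃ[ℝ] XLamPoly d) (ν₃ : XLamPoly d),
      IsFractionForm P q ν₁ ν₂ ν₃ →
      ∀ (l : Fin (k₁ + k₂ + 1) → ℝ) (γ : ℝ),
        ((∀ z : ℂ, ‖z‖ = 1 → ∀ lam ∈ stdSimplex ℝ (Fin d),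
            0 < γ ^ 2 - ‖errorTF P q l z lam‖ ^ 2) ↔
          ∃ ε : ℝ, 0 < ε ∧ ∃ k : ℕ,
            IsSOSMatrixPolynomial fun (x : ℝ) (lam : Fin d → ℝ) =>
              ((1 + x ^ 2) ^ degX (matT γ (ν₁ l) (ν₂ l) ν₃) * l2norm lam ^ (2 * k)) •
                (hatMat (matT γ (ν₁ l) (ν₂ l) ν₃) x (sqVec lam) -
                  (ε * l2norm lam ^ (2 * degLam (matT γ (ν₁ l) (ν₂ l) ν₃))) •
                    (1 : Matrix (Fin 3) (Fin 3) ℝ))) := by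
  refine ⟨exists_isFractionForm P hP k₁ k₂ k₃ k₄ q, fun ν₁ ν₂ ν₃ hν l γ => ⟨fun h => ?_, ?_⟩⟩
  · refine exists_isSOSMatrixPolynomial _ ?_ fun x₁ x₂ hx y hy v hv => ?_
    · intro i j
      fin_cases i <;> fin_cases j <;> rfl
    · have hpos := (hν.pos_iff l γ hx hy).1 (h _ (norm_circle_coordinates hx) y hy)
      rw [matT_quadratic_form]
      by_cases h0 : v 0 = 0
      · have h12 : 0 < v 1 ^ 2 + v 2 ^ 2 := by
          by_contra hle
          have h1 : v 1 = 0 := by nlinarith [sq_nonneg (v 1), sq_nonneg (v 2)]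
          have h2 : v 2 = 0 := by nlinarith [sq_nonneg (v 1), sq_nonneg (v 2)]
          refine hv (funext fun i => ?_)
          fin_cases i
          exacts [h0, h1, h2]
        rw [h0]
        linarith
      · have := mul_pos hpos (sq_pos_of_ne_zero h0)
        positivity
  · rintro ⟨ε, hε, k, hk⟩ z hz lam hlam
    obtain ⟨x₁, x₂, hx, rfl⟩ := exists_circle_coordinates hz
    rw [hν.pos_iff l γ hx hlam]
    -- this vector annihilates the two squares of the quadratic form
    have h1 := lower_bound_of_isSOSMatrixPolynomial _ hk hx hlam
      ![1, -(ν₁ l).at x₁ x₂ lam, -(ν₂ l).at x₁ x₂ lam]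
    rw [matT_quadratic_form, Fin.sum_univ_three] at h1
    simp at h1
    refine lt_of_lt_of_le ?_ h1
    positivity
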